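/- Let $\boldsymbol{k}$ be a field of characteristic zero, let $m\ge 2$ be an even integer and let $S$ be a commutative $\boldsymbol{k}$-algebra with a Nambu-Poisson bracket of arity $m$, i.e. a $\boldsymbol{k}$-multilinear antisymmetric map $\{\ ,\dots,\ \}:S^m\to S$ such that $$\{a_1,\dots,a_{m-1},bc\}=b\{a_1,\dots,a_{m-1},c\}+c\{a_1,\dots,a_{m-1},b\},$$ $$\{a_1,\dots,a_{m-1},\{b_1,\dots,b_m\}\}=\sum_{l=1}^m\{b_1,\dots,b_{l-1},\{a_1,\dots,a_{m-1},b_l\},b_{l+1},\dots,b_m\}.$$ Let $I\subseteq S$ be a Nambu-Poisson ideal, i.e. an ideal with $\{I,S,\dots,S\}\subseteq I$, and let $A=S/I$ be the quotient Nambu-Poisson algebra, with bracket $\{g_1+I,\dots,g_m+I\}=\{g_1,\dots,g_m\}+I$ and Hamiltonian vector fields $X_{a_1\dots a_{m-1}}=\{a_1,\dots,a_{m-1},\ \cdot\ \}\in\operatorname{Der}(A)$. Then $$[\mathrm{d}a_1,\dots,\mathrm{d}a_m]=\mathrm{d}\{a_1,\dots,a_m\},\qquad \rho(\mathrm{d}a_1,\dots,\mathrm{d}a_{m-1},\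 \cdot\ )=X_{a_1\dots a_{m-1}}\qquad(a_1,\dots,a_m\in A)$$ define a Lie-Rinehart $m$-algebra structure on the $A$-module $\Omega_{A|\boldsymbol{k}}$ of Kähler differentials, i.e. there is exactly one such structure satisfying these equations. Here a Lie-Rinehart $m$-algebra structure on an $A$-module $V$ consists of a $\boldsymbol{k}$-multilinear alternating bracket $[\ ,\dots,\ ]:V^m\to V$ and an anchor $\rho:V^{m-1}\times A\to A$, which is $A$-multilinear and alternating in the first $m-1$ arguments and $\boldsymbol{k}$-linear in the last one, such that for all $v_i\in V$ and $a,b\in A$ $$\sum_{\sigma\in \mathrm{Sh}^{-1}_{m,m-1}}(-1)^\sigma[[v_{\sigma(1)},\dots,v_{\sigma(m)}],v_{\sigma(m+1)},\dots,v_{\sigma(2m-1)}]=0,$$ $$[v_1,\dots,v_{m-1},av_m]=a[v_1,\dots,v_m]+\rho(v_1,\dots,v_{m-1},a)v_m,$$ $$\sum_{\sigma\in \mathrm{Sh}^{-1}_{m,m-2}}(-1)^\sigma\rho([v_{\sigma(1)},\dots,v_{\sigma(m)}],v_{\sigma(m+1)},\dots,v_{\sigma(2m-2)},a)+\sum_{\sigma\in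 \mathrm{Sh}^{-1}_{m-1,m-1}}(-1)^\sigma\rho(v_{\sigma(m)},\dots,v_{\sigma(2m-2)},\rho(v_{\sigma(1)},\dots,v_{\sigma(m-1)},a))=0,$$ $$\rho(v_1,\dots,v_{m-1},ab)=a\rho(v_1,\dots,v_{m-1},b)+b\rho(v_1,\dots,v_{m-1},a),$$ where $\mathrm{Sh}^{-1}_{q,r}$ is the set of permutations $\sigma$ of $\{1,\dots,q+r\}$ with $\sigma(1)<\dots<\sigma(q)$ and $\sigma(q+1)<\dots<\sigma(q+r)$, and $(-1)^\sigma$ is the sign of $\sigma$. -/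

import Mathlib

open scoped KaehlerDifferential

/-- A Nambu-Poisson structure of arity `m = p + 2` on the commutative `k`-algebra `S`: a
`k`-multilinear alternating bracket `{a₁, …, aₘ}` satisfying the Leibniz rule (in the last, hence in
every, argument) and the fundamental (Filippov) identity. -/
structure NambuPoisson (k S : Type*) [Field k] [CommRing S] [Algebra k S] (p : ℕ) where
  /-- The bracket `{a₁, …, aₘ}`. -/
  bracket : S [⋀^Fin (p + 2)]→ₗ[k] S
  /-- `{a₁, …, aₘ₋₁, b c} = b {a₁, …, aₘ₋₁, c} + c {a₁, …, aₘ₋₁, b}` -/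
  leibniz : ∀ (a : Fin (p + 1) → S) (b c : S),
    bracket (Fin.snoc a (b * c)) = b * bracket (Fin.snoc a c) + c * bracket (Fin.snoc a b)
  /-- `{a₁, …, aₘ₋₁, {b₁, …, bₘ}} = ∑ₗ {b₁, …, {a₁, …, aₘ₋₁, bₗ}, …, bₘ}` -/
  fundamental : ∀ (a : Fin (p + 1) → S) (b : Fin (p + 2) → S),
    bracket (Fin.snoc a (bracket b)) =
      ∑ l : Fin (p + 2), bracket (Function.update b l (bracket (Fin.snoc a (b l))))

namespace NambuPoisson

variable {k S : Type*} [Field k] [CommRing S] [Algebra k S] {p : ℕ}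

/-- The Hamiltonian vector field `X_{a₁, …, aₘ₋₁} = {a₁, …, aₘ₋₁, ·}`, a `k`-derivation. -/
def hamiltonian (P : NambuPoisson k S p) (a : Fin (p + 1) → S) : Derivation k S S :=
  Derivation.mk'
    { toFun := fun b => P.bracket (Fin.snoc a b)
      map_add' := fun b c => by
        have h := P.bracket.map_update_add (Fin.snoc a (0 : S)) (Fin.last (p + 1)) b c
        simpa only [Fin.update_snoc_last] using h
      map_smul' := fun t b => by
        have h := P.bracket.map_update_smul (Fin.snoc a (0 : S)) (Fin.last (p + 1)) t b
        simpa only [Fin.update_snoc_last, RingHom.id_apply] using h }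
    (fun b c => P.leibniz a b c)

/-- `I` is a Nambu-Poisson ideal: `{I, S, …, S} ⊆ I`. -/
def IsNambuIdeal (P : NambuPoisson k S p) (I : Ideal S) : Prop :=
  ∀ f ∈ I, ∀ a : Fin (p + 1) → S, P.bracket (Fin.cons f a) ∈ I

theorem IsNambuIdeal.update_mem {P : NambuPoisson k S p} {I : Ideal S} (hI : P.IsNambuIdeal I)
    (u : Fin (p + 2) → S) (i : Fin (p + 2)) {f : S} (hf : f ∈ I) :
    P.bracket (Function.update u i f) ∈ I := by
  set w := Function.update u i f with hw
  have h0 : w i = f := by simp [hw]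
  have hmem : P.bracket (w ∘ Equiv.swap 0 i) ∈ I := by
    have := hI f hf (Fin.tail (w ∘ Equiv.swap 0 i))
    have e : (Fin.cons f (Fin.tail (w ∘ Equiv.swap 0 i)) : Fin (p + 2) → S)
        = w ∘ Equiv.swap 0 i := by
      have h1 : f = (w ∘ Equiv.swap 0 i) 0 := by simp [h0]
      conv_lhs => rw [h1]
      exact Fin.cons_self_tail _
    rwa [e] at this
  rw [P.bracket.map_perm] at hmem
  rcases Int.units_eq_one_or (Equiv.Perm.sign (Equiv.swap 0 i)) with h | h
  · rw [h, one_smul] at hmem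
    exact hmem
  · rw [h, Units.neg_smul, one_smul] at hmem
    exact neg_mem_iff.mp hmem

/-- The bracket modulo a Nambu-Poisson ideal depends only on the classes of its arguments. -/
theorem IsNambuIdeal.mk_congr {P : NambuPoisson k S p} {I : Ideal S} (hI : P.IsNambuIdeal I)
    (u w : Fin (p + 2) → S) (h : ∀ i, Ideal.Quotient.mk I (u i) = Ideal.Quotient.mk I (w i)) :
    Ideal.Quotient.mk I (P.bracket u) = Ideal.Quotient.mk I (P.bracket w) := by
  classical
  have key : ∀ s : Finset (Fin (p + 2)),
      Ideal.Quotient.mk I (P.bracket (s.piecewise w u)) = Ideal.Quotient.mk I (P.bracket u) := by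
    intro s
    induction s using Finset.induction_on with
    | empty => simp
    | insert i s his ih =>
      rw [← ih, Finset.piecewise_insert, Ideal.Quotient.eq]
      have e : (s.piecewise w u) = Function.update (s.piecewise w u) i (u i) := by
        rw [Function.eq_update_iff]
        simp [his]
      have e2 : P.bracket (s.piecewise w u)
          = P.bracket (Function.update (s.piecewise w u) i (u i)) := congrArg _ e
      rw [e2, ← P.bracket.map_update_sub]
      exact hI.update_mem _ _ (Ideal.Quotient.eq.mp (h i).symm)
  have := key Finset.univ
  rw [Finset.piecewise_univ] at this
  exact this.symm

/-- The underlying function of the bracket on `S ⧸ I`, computed on representatives. -/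
noncomputable def quotientFun (P : NambuPoisson k S p) (I : Ideal S) (v : Fin (p + 2) → S ⧸ I) :
    S ⧸ I :=
  Ideal.Quotient.mk I (P.bracket fun i => (v i).out)

theorem IsNambuIdeal.quotientFun_mk {P : NambuPoisson k S p} {I : Ideal S}
    (hI : P.IsNambuIdeal I) (u : Fin (p + 2) → S) :
    P.quotientFun I (fun i => Ideal.Quotient.mk I (u i)) = Ideal.Quotient.mk I (P.bracket u) :=
  hI.mk_congr _ _ fun _ => Ideal.Quotient.mk_out _

theorem mk_update {I : Ideal S} (u : Fin (p + 2) → S) (i : Fin (p + 2)) (x : S) :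
    Function.update (fun j => Ideal.Quotient.mk I (u j)) i (Ideal.Quotient.mk I x) =
      fun j => Ideal.Quotient.mk I (Function.update u i x j) := by
  funext j
  exact (Function.apply_update (fun _ => Ideal.Quotient.mk I) u i x j).symm

theorem mk_snoc {I : Ideal S} (a : Fin (p + 1) → S) (x : S) :
    (Fin.snoc (fun j => Ideal.Quotient.mk I (a j)) (Ideal.Quotient.mk I x) :
        Fin (p + 2) → S ⧸ I) =
      fun j => Ideal.Quotient.mk I ((Fin.snoc a x : Fin (p + 2) → S) j) := by
  funext j
  refine Fin.lastCases ?_ (fun i => ?_) j <;> simp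

theorem exists_lift {I : Ideal S} {n : ℕ} (v : Fin n → S ⧸ I) :
    ∃ u : Fin n → S, v = fun j => Ideal.Quotient.mk I (u j) :=
  ⟨fun j => (v j).out, funext fun _ => (Ideal.Quotient.mk_out _).symm⟩

/-- The bracket induced on the quotient by a Nambu-Poisson ideal. -/
noncomputable def quotientBracket (P : NambuPoisson k S p) (I : Ideal S) (hI : P.IsNambuIdeal I) :
    (S ⧸ I) [⋀^Fin (p + 2)]→ₗ[k] (S ⧸ I) where
  toFun := P.quotientFun I
  map_update_add' := by
    intro inst v i x y
    obtain rfl : inst = instDecidableEqFin (p + 2) := Subsingleton.elim _ _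
    obtain ⟨u, rfl⟩ := exists_lift v
    obtain ⟨x, rfl⟩ := Ideal.Quotient.mk_surjective x
    obtain ⟨y, rfl⟩ := Ideal.Quotient.mk_surjective y
    rw [← map_add]
    simp only [mk_update, hI.quotientFun_mk]
    rw [P.bracket.map_update_add, map_add]
  map_update_smul' := by
    intro inst v i t x
    obtain rfl : inst = instDecidableEqFin (p + 2) := Subsingleton.elim _ _
    obtain ⟨u, rfl⟩ := exists_lift v
    obtain ⟨x, rfl⟩ := Ideal.Quotient.mk_surjective x
    have hs : ∀ z : S, t • Ideal.Quotient.mk I z = Ideal.Quotient.mk I (t • z) := fun _ => rfl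
    rw [hs]
    simp only [mk_update, hI.quotientFun_mk]
    rw [P.bracket.map_update_smul, hs]
  map_eq_zero_of_eq' := by
    intro v i j hij hne
    have h : (fun l => (v l).out) i = (fun l => (v l).out) j := by simp only [hij]
    change Ideal.Quotient.mk I (P.bracket fun l => (v l).out) = 0
    rw [P.bracket.map_eq_zero_of_eq _ h hne, map_zero]

theorem quotientBracket_mk (P : NambuPoisson k S p) (I : Ideal S) (hI : P.IsNambuIdeal I)
    (u : Fin (p + 2) → S) :
    P.quotientBracket I hI (fun i => Ideal.Quotient.mk I (u i)) =
      Ideal.Quotient.mk I (P.bracket u) :=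
  hI.quotientFun_mk u

/-- The quotient Nambu-Poisson algebra `S ⧸ I` of `S` by a Nambu-Poisson ideal `I`, with bracket
`{g₁ + I, …, gₘ + I} = {g₁, …, gₘ} + I`. -/
noncomputable def quotient (P : NambuPoisson k S p) (I : Ideal S) (hI : P.IsNambuIdeal I) :
    NambuPoisson k (S ⧸ I) p where
  bracket := P.quotientBracket I hI
  leibniz := by
    intro a b c
    obtain ⟨a, rfl⟩ := exists_lift a
    obtain ⟨b, rfl⟩ := Ideal.Quotient.mk_surjective b
    obtain ⟨c, rfl⟩ := Ideal.Quotient.mk_surjective c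
    rw [← map_mul]
    simp only [mk_snoc, quotientBracket_mk]
    rw [P.leibniz, map_add, map_mul, map_mul]
  fundamental := by
    intro a b
    obtain ⟨a, rfl⟩ := exists_lift a
    obtain ⟨b, rfl⟩ := exists_lift b
    simp only [mk_snoc, mk_update, quotientBracket_mk]
    rw [P.fundamental, map_sum]

/-- The defining property of the quotient bracket. -/
theorem quotient_bracket_mk (P : NambuPoisson k S p) (I : Ideal S) (hI : P.IsNambuIdeal I)
    (g : Fin (p + 2) → S) :
    (P.quotient I hI).bracket (fun i => Ideal.Quotient.mk I (g i)) =
      Ideal.Quotient.mk I (P.bracket g) :=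
  P.quotientBracket_mk I hI g

end NambuPoisson

/-- The set `Sh⁻¹_{q,r}` of `(q, r)`-unshuffles: the permutations `σ` of `q + r` letters with
`σ 1 < ⋯ < σ q` and `σ (q + 1) < ⋯ < σ (q + r)`. -/
def unshuffles (q r : ℕ) : Finset (Equiv.Perm (Fin (q + r))) :=
  {σ | (∀ i j : Fin q, i < j → σ (Fin.castAdd r i) < σ (Fin.castAdd r j)) ∧
    ∀ i j : Fin r, i < j → σ (Fin.natAdd q i) < σ (Fin.natAdd q j)}

/-- A Lie-Rinehart `m`-algebra structure, `m = p + 2`, on the module `V` over the `k`-algebra `A`: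
a `k`-linear bracket `⋀ᵐ V → V` and an anchor `ρ : ⋀_A^{m-1} V ⊗_k A → A`, where
`ρ (v₁, …, vₘ₋₁, a)` is written `anchor v a`. -/
@[ext]
structure LieRinehartMAlgebra (k A V : Type*) [Field k] [CommRing A] [Algebra k A]
    [AddCommGroup V] [Module A V] [Module k V] [IsScalarTower k A V] (p : ℕ) where
  /-- The bracket `[v₁, …, vₘ]`. -/
  bracket : V [⋀^Fin (p + 2)]→ₗ[k] V
  /-- The anchor `ρ (v₁, …, vₘ₋₁, a)`; `A`-linear in the `vᵢ` and `k`-linear in `a`. -/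
  anchor : V [⋀^Fin (p + 1)]→ₗ[A] (A →ₗ[k] A)
  /-- The Jacobi identity, a signed sum over the `(m, m - 1)`-unshuffles. -/
  jacobi : ∀ v : Fin ((p + 2) + (p + 1)) → V,
    ∑ σ ∈ unshuffles (p + 2) (p + 1), (Equiv.Perm.sign σ : ℤ) •
      bracket (Fin.cons (bracket fun i => v (σ (Fin.castAdd (p + 1) i)))
        fun j => v (σ (Fin.natAdd (p + 2) j))) = 0
  /-- `[v₁, …, vₘ₋₁, a vₘ] = a [v₁, …, vₘ] + ρ (v₁, …, vₘ₋₁, a) vₘ` -/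
  bracket_leibniz : ∀ (v : Fin (p + 1) → V) (a : A) (w : V),
    bracket (Fin.snoc v (a • w)) = a • bracket (Fin.snoc v w) + anchor v a • w
  /-- Compatibility of the anchor with the bracket: the terms with the bracket inside are summed over
  the `(m, m - 2)`-unshuffles, the iterated anchors over the `(m - 1, m - 1)`-unshuffles. -/
  anchor_bracket : ∀ (v : Fin ((p + 1) + (p + 1)) → V) (a : A),
    ∑ σ ∈ unshuffles (p + 2) p, (Equiv.Perm.sign σ : ℤ) •
        anchor (Fin.cons
          (bracket fun i => v (Fin.cast (by omega) (σ (Fin.castAdd p i))))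
          fun j => v (Fin.cast (by omega) (σ (Fin.natAdd (p + 2) j)))) a
      + ∑ σ ∈ unshuffles (p + 1) (p + 1), (Equiv.Perm.sign σ : ℤ) •
        anchor (fun j => v (σ (Fin.natAdd (p + 1) j)))
          (anchor (fun i => v (σ (Fin.castAdd (p + 1) i))) a) = 0
  /-- `ρ (v₁, …, vₘ₋₁, a b) = a ρ (v₁, …, vₘ₋₁, b) + b ρ (v₁, …, vₘ₋₁, a)` -/
  anchor_leibniz : ∀ (v : Fin (p + 1) → V) (a b : A),
    anchor v (a * b) = a * anchor v b + b * anchor v a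

/-! The quotient `A = S ⧸ I` enters only as a Nambu-Poisson algebra. Exact differentials generate
`Ω[A⁄k]` over `A`, so the Leibniz rule and the prescribed values determine the structure
(`LieRinehartMAlgebra.ext_of_D`). Existence needs a formula defined on all differentials.

The Nambu bracket is an alternating multiderivation, so it comes from an `A`-multilinear form π on
differentials (`poissonTensor`). Contracting π with m - 1 differentials gives vector fields X, hence
the anchor. The bracket is an m-ary Koszul formula, [v₀, …, vₘ₋₁] = -∑ᵢ (-1)^i L_{X(v without vᵢ)}
vᵢ - (m - 1) dπ(v).

For the two remaining identities, sums over unshuffles are replaced by sums over all permutations,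
which in characteristic zero only changes a nonzero factor. This gives `jacobiator` and
`anchorDefect`, both skew by construction, so linearity in the first argument suffices. For m even
the non-tensorial terms of `anchorDefect` cancel, and `jacobiator` fails to be `A`-linear exactly by
an `anchorDefect` term (`anchorDefect_cons_smul`, `jacobiator_cons_smul`). Both therefore vanish if
they vanish on exact differentials. There they reduce to the jacobiator J of the Nambu bracket on
`A`, the function argument of the anchor serving as one more entry.

Finally J = 0 (`NambuPoisson.jacobiator_eq_zero`): the fundamental identity gives J = m H, where H
is the signed sum of {{x₀, y}, x₁, …, xₘ₋₁}. Exchanging two blocks of odd size m - 1 gives H = -J,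
so (m + 1) J = 0. -/

/-! ### Signed sums over permutations and their reduction to unshuffles -/

section ShuffleSum

variable {V M : Type*} {n q r : ℕ}

/-- The first `q` entries of a tuple of length `n = q + r`. -/
def firstBlock (h : q + r = n) (v : Fin n → V) : Fin q → V :=
  fun i => v (Fin.cast h (Fin.castAdd r i))

/-- The last `r` entries of a tuple of length `n = q + r`. -/
def lastBlock (h : q + r = n) (v : Fin n → V) : Fin r → V :=
  fun j => v (Fin.cast h (Fin.natAdd q j))

variable [AddCommGroup M]

/-- The signed sum of `G` over all permutations of the arguments `v`, where `G` takes the first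
`q` and the last `r` arguments separately. -/
def shuffleSum (h : q + r = n) (G : (Fin q → V) → (Fin r → V) → M) (v : Fin n → V) : M :=
  ∑ σ : Equiv.Perm (Fin n), (Equiv.Perm.sign σ : ℤ) •
    G (firstBlock h (v ∘ σ)) (lastBlock h (v ∘ σ))

/-- Reindexing by left multiplication; no symmetry of `G` is needed, which is why full permutation
sums are easier to handle than unshuffle sums. -/
theorem shuffleSum_comp_perm (h : q + r = n) (G : (Fin q → V) → (Fin r → V) → M)
    (v : Fin n → V) (π : Equiv.Perm (Fin n)) :
    shuffleSum h G (v ∘ π) = (Equiv.Perm.sign π : ℤ) • shuffleSum h G v := by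
  rw [shuffleSum, shuffleSum, Finset.smul_sum]
  refine Fintype.sum_equiv (Equiv.mulLeft π) _ _ fun σ => ?_
  rw [smul_smul, Equiv.coe_mulLeft, Equiv.Perm.sign_mul, Units.val_mul, ← mul_assoc,
    Int.units_coe_mul_self, one_mul, Equiv.Perm.coe_mul, Function.comp_assoc]

/-- Right multiplication permutes the slots of `F` rather than the arguments; this is the tool for
exchanging or rearranging blocks. -/
theorem sum_sign_smul_comp_perm (F : (Fin n → V) → M) (v : Fin n → V) (π : Equiv.Perm (Fin n)) :
    ∑ σ : Equiv.Perm (Fin n), (Equiv.Perm.sign σ : ℤ) • F (v ∘ σ ∘ π) =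
      (Equiv.Perm.sign π : ℤ) •
        ∑ σ : Equiv.Perm (Fin n), (Equiv.Perm.sign σ : ℤ) • F (v ∘ σ) := by
  rw [Finset.smul_sum]
  refine Fintype.sum_equiv (Equiv.mulRight π) _ _ fun σ => ?_
  rw [smul_smul, Equiv.coe_mulRight, Equiv.Perm.sign_mul, Units.val_mul, mul_comm (_ : ℤ),
    mul_assoc, Int.units_coe_mul_self, mul_one, Equiv.Perm.coe_mul]

theorem shuffleSum_congr (h : q + r = n) {G G' : (Fin q → V) → (Fin r → V) → M}
    (hG : ∀ x y, G x y = G' x y) (v : Fin n → V) : shuffleSum h G v = shuffleSum h G' v := by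
  simp only [shuffleSum, hG]

theorem shuffleSum_add (h : q + r = n) (G G' : (Fin q → V) → (Fin r → V) → M) (v : Fin n → V) :
    shuffleSum h (fun x y => G x y + G' x y) v = shuffleSum h G v + shuffleSum h G' v := by
  simp only [shuffleSum, smul_add, Finset.sum_add_distrib]

theorem shuffleSum_map {N : Type*} [AddCommGroup N] (φ : M →+ N) (h : q + r = n)
    (G : (Fin q → V) → (Fin r → V) → M) (v : Fin n → V) :
    shuffleSum h (fun x y => φ (G x y)) v = φ (shuffleSum h G v) := by
  simp only [shuffleSum, map_sum, map_zsmul]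

theorem shuffleSum_neg (h : q + r = n) (G : (Fin q → V) → (Fin r → V) → M) (v : Fin n → V) :
    shuffleSum h (fun x y => -G x y) v = -shuffleSum h G v := by
  simp only [shuffleSum, smul_neg, Finset.sum_neg_distrib]

theorem shuffleSum_smul {R : Type*} [Ring R] [Module R M] (h : q + r = n) (a : R)
    (G : (Fin q → V) → (Fin r → V) → M) (v : Fin n → V) :
    shuffleSum h (fun x y => a • G x y) v = a • shuffleSum h G v := by
  simp only [shuffleSum, Finset.smul_sum, smul_comm a]

theorem shuffleSum_smul_const {R : Type*} [Ring R] [Module R M] (h : q + r = n)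
    (G : (Fin q → V) → (Fin r → V) → R) (w : M) (v : Fin n → V) :
    shuffleSum h (fun x y => G x y • w) v = shuffleSum h G v • w := by
  simp only [shuffleSum, Finset.sum_smul, smul_assoc]

theorem shuffleSum_comp_map {W : Type*} (h : q + r = n) (d : W → V)
    (G : (Fin q → V) → (Fin r → V) → M) (a : Fin n → W) :
    shuffleSum h G (d ∘ a) = shuffleSum h (fun x y => G (d ∘ x) (d ∘ y)) a :=
  rfl

theorem finRotate_pow_val (s : ℕ) (i : Fin (n + 1)) :
    ((finRotate (n + 1) ^ s) i : ℕ) = (i + s) % (n + 1) := by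
  induction s with
  | zero => simp [Nat.mod_eq_of_lt i.isLt]
  | succ s ih =>
    rw [pow_succ', Equiv.Perm.mul_apply, finRotate_apply, Fin.val_add, ih, Fin.val_one',
      Nat.mod_add_mod, Nat.add_mod_mod, Nat.add_assoc]

/-- Exchanging the two blocks of arguments. -/
theorem shuffleSum_swap_blocks (h : q + r = n) (h' : r + q = n)
    (G : (Fin q → V) → (Fin r → V) → M) (v : Fin n → V) :
    shuffleSum h' (fun y x => G x y) v = (-1 : ℤ) ^ (q * r) • shuffleSum h G v := by
  cases n with
  | zero =>
    obtain rfl : q = 0 := by omega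
    obtain rfl : r = 0 := by omega
    simp only [shuffleSum, zero_mul, pow_zero, one_smul]
    refine Finset.sum_congr rfl fun σ _ => ?_
    congr 2 <;> exact Subsingleton.elim _ _
  | succ n =>
    -- Exchanging the blocks is rotation by `r`, of sign (-1)^(n r). Since n + q = 2q + r - 1, the
    -- parities of n r and q r differ by that of r (r - 1), which is even.
    have hs : ((Equiv.Perm.sign (finRotate (n + 1) ^ r) : ℤˣ) : ℤ) = (-1) ^ (q * r) := by
      rw [map_pow, sign_finRotate, Nat.add_sub_cancel, ← pow_mul]
      push_cast
      obtain ⟨c, hc⟩ : Even (n * r + q * r) := by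
        rw [← add_mul]
        rcases Nat.even_or_odd r with hr | hr
        · exact hr.mul_left _
        · refine Even.mul_right ?_ _
          have : n + q = 2 * q + (r - 1) := by obtain ⟨c, rfl⟩ := hr; omega
          rw [this]
          obtain ⟨c, rfl⟩ := hr
          exact ⟨q + c, by omega⟩
      exact neg_one_pow_congr (by
        rw [← Nat.even_add]; exact ⟨c, hc⟩)
    rw [← hs, shuffleSum, shuffleSum]
    rw [← sum_sign_smul_comp_perm (fun x => G (firstBlock h x) (lastBlock h x)) v
      (finRotate (n + 1) ^ r)]
    refine Finset.sum_congr rfl fun σ _ => ?_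
    congr 2
    · funext i
      refine congrArg (fun t => v (σ t)) (Fin.ext ?_)
      have := i.isLt
      rw [finRotate_pow_val]
      simp only [Fin.val_cast, Fin.val_castAdd, Fin.val_natAdd]
      rw [Nat.mod_eq_of_lt] <;> omega
    · funext i
      refine congrArg (fun t => v (σ t)) (Fin.ext ?_)
      have := i.isLt
      rw [finRotate_pow_val]
      simp only [Fin.val_cast, Fin.val_castAdd, Fin.val_natAdd]
      rw [show q + (i : ℕ) + r = i + (n + 1) by omega, Nat.add_mod_right, Nat.mod_eq_of_lt]
      omega

/-- Splitting a permutation of `n + 1` letters according to the preimage of the first letter. -/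
theorem sum_sign_smul_cons (F : (Fin (n + 1) → V) → M) (w : V) (u : Fin n → V) :
    ∑ σ : Equiv.Perm (Fin (n + 1)), (Equiv.Perm.sign σ : ℤ) • F ((Fin.cons w u : Fin (n+1) → V) ∘ σ)
      = ∑ j : Fin (n + 1), (-1 : ℤ) ^ (j : ℕ) •
        ∑ τ : Equiv.Perm (Fin n), (Equiv.Perm.sign τ : ℤ) • F (j.insertNth w (u ∘ τ)) := by
  -- `e (j, τ)` sends `j` to `0` and acts as `τ` on the other letters; the cycle bringing `j` to the
  -- front contributes the sign (-1)^j.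
  let e : Fin (n + 1) × Equiv.Perm (Fin n) → Equiv.Perm (Fin (n + 1)) :=
    fun x => Equiv.Perm.decomposeFin.symm (0, x.2) * x.1.cycleRange
  have he : Function.Bijective e := by
    rw [Fintype.bijective_iff_injective_and_card]
    refine ⟨?_, ?_⟩
    · rintro ⟨j, τ⟩ ⟨j', τ'⟩ h
      have h0 : ∀ x : Fin (n + 1) × Equiv.Perm (Fin n), e x x.1 = 0 := fun x => by simp [e]
      obtain rfl : j = j' := (e (j, τ)).injective ((h0 (j, τ)).trans (by rw [h]; exact (h0 _).symm))
      have := Equiv.Perm.decomposeFin.symm.injective (mul_right_cancel h)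
      simpa using this
    · simp [Fintype.card_perm, Nat.factorial_succ]
  simp only [Finset.smul_sum]
  rw [← Fintype.sum_prod_type', ← he.sum_comp]
  refine Finset.sum_congr rfl fun x _ => ?_
  obtain ⟨j, τ⟩ := x
  have hs : ((Equiv.Perm.sign (e (j, τ)) : ℤˣ) : ℤ) = (-1) ^ (j : ℕ) * (Equiv.Perm.sign τ : ℤ) := by
    simp [e, Fin.sign_cycleRange, mul_comm]
  rw [hs, mul_smul]
  congr 3
  rw [← Fin.cons_comp_cycleRange]
  simp only [e, Equiv.Perm.coe_mul, ← Function.comp_assoc]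
  congr 1
  funext i
  refine Fin.cases ?_ (fun i => ?_) i <;> simp

theorem eq_insertNth_of_forall {j : Fin (n + 1)} {w : V} {f : Fin (n + 1) → V} {g : Fin n → V}
    (hj : f j = w) (h : ∀ i, f (j.succAbove i) = g i) : f = j.insertNth w g :=
  Fin.eq_insertNth_iff.mpr ⟨hj, funext h⟩

theorem firstBlock_insertNth_castAdd (h : q + 1 + r = n + 1) (h' : q + r = n) (j : Fin (q + 1))
    (w : V) (u : Fin n → V) :
    firstBlock h ((Fin.cast h (Fin.castAdd r j)).insertNth w u) = j.insertNth w (firstBlock h' u) := by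
  refine eq_insertNth_of_forall (Fin.insertNth_apply_same _ _ _) fun i => ?_
  have e : Fin.cast h (Fin.castAdd r (j.succAbove i)) =
      (Fin.cast h (Fin.castAdd r j)).succAbove (Fin.cast h' (Fin.castAdd r i)) := by
    ext; simp only [Fin.succAbove, Fin.lt_def]; simp; split_ifs <;> simp
  rw [firstBlock, e, Fin.insertNth_apply_succAbove, firstBlock]

theorem lastBlock_insertNth_castAdd (h : q + 1 + r = n + 1) (h' : q + r = n) (j : Fin (q + 1))
    (w : V) (u : Fin n → V) :
    lastBlock h ((Fin.cast h (Fin.castAdd r j)).insertNth w u) = lastBlock h' u := by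
  funext i
  have e : Fin.cast h (Fin.natAdd (q + 1) i) =
      (Fin.cast h (Fin.castAdd r j)).succAbove (Fin.cast h' (Fin.natAdd q i)) := by
    have := j.isLt
    ext; simp only [Fin.succAbove, Fin.lt_def]; simp; split_ifs <;> simp <;> omega
  rw [lastBlock, e, Fin.insertNth_apply_succAbove, lastBlock]

theorem firstBlock_insertNth_natAdd (h : q + (r + 1) = n + 1) (h' : q + r = n) (j : Fin (r + 1))
    (w : V) (u : Fin n → V) :
    firstBlock h ((Fin.cast h (Fin.natAdd q j)).insertNth w u) = firstBlock h' u := by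
  funext i
  have e : Fin.cast h (Fin.castAdd (r + 1) i) =
      (Fin.cast h (Fin.natAdd q j)).succAbove (Fin.cast h' (Fin.castAdd r i)) := by
    have := i.isLt
    ext; simp only [Fin.succAbove, Fin.lt_def]; simp; split_ifs
    all_goals simp
    omega
  rw [firstBlock, e, Fin.insertNth_apply_succAbove, firstBlock]

theorem lastBlock_insertNth_natAdd (h : q + (r + 1) = n + 1) (h' : q + r = n) (j : Fin (r + 1))
    (w : V) (u : Fin n → V) :
    lastBlock h ((Fin.cast h (Fin.natAdd q j)).insertNth w u) = j.insertNth w (lastBlock h' u) := by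
  refine eq_insertNth_of_forall (Fin.insertNth_apply_same _ _ _) fun i => ?_
  have e : Fin.cast h (Fin.natAdd q (j.succAbove i)) =
      (Fin.cast h (Fin.natAdd q j)).succAbove (Fin.cast h' (Fin.natAdd q i)) := by
    ext; simp only [Fin.succAbove, Fin.lt_def]; simp; split_ifs <;> simp <;> omega
  rw [lastBlock, e, Fin.insertNth_apply_succAbove, lastBlock]

/-- The shuffle sum with `w` as its first argument, split according to the block that contains
`w`. -/
theorem shuffleSum_cons_eq_sum (h : q + r = n + 1) (G : (Fin q → V) → (Fin r → V) → M)
    (w : V) (u : Fin n → V) :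
    shuffleSum h G (Fin.cons w u) =
      ∑ j : Fin q, (-1 : ℤ) ^ (j : ℕ) • ∑ τ : Equiv.Perm (Fin n), (Equiv.Perm.sign τ : ℤ) •
        G (firstBlock h ((Fin.cast h (Fin.castAdd r j)).insertNth w (u ∘ τ)))
          (lastBlock h ((Fin.cast h (Fin.castAdd r j)).insertNth w (u ∘ τ))) +
      ∑ j : Fin r, (-1 : ℤ) ^ (q + j) • ∑ τ : Equiv.Perm (Fin n), (Equiv.Perm.sign τ : ℤ) •
        G (firstBlock h ((Fin.cast h (Fin.natAdd q j)).insertNth w (u ∘ τ)))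
          (lastBlock h ((Fin.cast h (Fin.natAdd q j)).insertNth w (u ∘ τ))) := by
  rw [shuffleSum, sum_sign_smul_cons (fun x => G (firstBlock h x) (lastBlock h x)),
    ← (finCongr h).sum_comp, Fin.sum_univ_add]
  rfl

/-- The sign (-1)^j of the splitting cancels the sign of moving `w` to the front of its block, so
all q + 1 positions contribute equally. -/
theorem sum_firstBlock_insertNth (h : q + 1 + r = n + 1) (h' : q + r = n)
    (G : (Fin (q + 1) → V) → (Fin r → V) → M) (w : V) (u : Fin n → V)
    (hG : ∀ (j : Fin (q + 1)) x y, G (j.insertNth w x) y = (-1 : ℤ) ^ (j : ℕ) • G (Fin.cons w x) y) :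
    ∑ j : Fin (q + 1), (-1 : ℤ) ^ (j : ℕ) • ∑ τ : Equiv.Perm (Fin n), (Equiv.Perm.sign τ : ℤ) •
        G (firstBlock h ((Fin.cast h (Fin.castAdd r j)).insertNth w (u ∘ τ)))
          (lastBlock h ((Fin.cast h (Fin.castAdd r j)).insertNth w (u ∘ τ))) =
      (q + 1) • shuffleSum h' (fun x y => G (Fin.cons w x) y) u := by
  simp only [firstBlock_insertNth_castAdd h h', lastBlock_insertNth_castAdd h h', hG]
  rw [Finset.sum_congr rfl (g := fun _ => shuffleSum h' (fun x y => G (Fin.cons w x) y) u)]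
  · simp
  · intro j _
    rw [shuffleSum, Finset.smul_sum]
    refine Finset.sum_congr rfl fun τ _ => ?_
    rw [smul_smul, mul_comm, mul_smul, smul_smul ((-1) ^ (j : ℕ)), ← pow_add,
      Even.neg_one_pow ⟨_, rfl⟩, one_smul]

/-- The same cancellation in the last block; (-1)^q remains from moving `w` past the first block. -/
theorem sum_lastBlock_insertNth (h : q + (r + 1) = n + 1) (h' : q + r = n)
    (G : (Fin q → V) → (Fin (r + 1) → V) → M) (w : V) (u : Fin n → V)
    (hG : ∀ (j : Fin (r + 1)) x y, G x (j.insertNth w y) = (-1 : ℤ) ^ (j : ℕ) • G x (Fin.cons w y)) :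
    ∑ j : Fin (r + 1), (-1 : ℤ) ^ (q + j) • ∑ τ : Equiv.Perm (Fin n), (Equiv.Perm.sign τ : ℤ) •
        G (firstBlock h ((Fin.cast h (Fin.natAdd q j)).insertNth w (u ∘ τ)))
          (lastBlock h ((Fin.cast h (Fin.natAdd q j)).insertNth w (u ∘ τ))) =
      (-1 : ℤ) ^ q • (r + 1) • shuffleSum h' (fun x y => G x (Fin.cons w y)) u := by
  simp only [firstBlock_insertNth_natAdd h h', lastBlock_insertNth_natAdd h h', hG]
  rw [Finset.sum_congr rfl
    (g := fun _ => (-1 : ℤ) ^ q • shuffleSum h' (fun x y => G x (Fin.cons w y)) u)]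
  · rw [Finset.sum_const, Finset.card_univ, Fintype.card_fin, smul_comm]
  · intro j _
    rw [shuffleSum, Finset.smul_sum, Finset.smul_sum]
    refine Finset.sum_congr rfl fun τ _ => ?_
    have hj : (-1 : ℤ) ^ (j : ℕ) * (-1) ^ (j : ℕ) = 1 := by
      rw [← pow_add, Even.neg_one_pow ⟨_, rfl⟩]
    simp only [smul_smul]
    congr 1
    rw [pow_add]
    linear_combination ((Equiv.Perm.sign τ : ℤ) * (-1) ^ q) * hj

theorem shuffleSum_cons (h : q + 1 + (r + 1) = n + 1) (h₁ : q + (r + 1) = n) (h₂ : q + 1 + r = n)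
    (G : (Fin (q + 1) → V) → (Fin (r + 1) → V) → M) (w : V) (u : Fin n → V)
    (hG₁ : ∀ (j : Fin (q + 1)) x y,
      G (j.insertNth w x) y = (-1 : ℤ) ^ (j : ℕ) • G (Fin.cons w x) y)
    (hG₂ : ∀ (j : Fin (r + 1)) x y,
      G x (j.insertNth w y) = (-1 : ℤ) ^ (j : ℕ) • G x (Fin.cons w y)) :
    shuffleSum h G (Fin.cons w u) =
      (q + 1) • shuffleSum h₁ (fun x y => G (Fin.cons w x) y) u +
        (-1 : ℤ) ^ (q + 1) • (r + 1) • shuffleSum h₂ (fun x y => G x (Fin.cons w y)) u := by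
  rw [shuffleSum_cons_eq_sum, sum_firstBlock_insertNth h h₁ G w u hG₁,
    sum_lastBlock_insertNth h h₂ G w u hG₂]

/-- If `G` is linear in the arguments of the last block, then so is the part of the shuffle sum in
which the first argument `w` is in the last block. -/
theorem exists_shuffleSum_cons_eq_add {R : Type*} [CommRing R] [AddCommGroup V] [Module R V]
    [Module R M] (h : q + 1 + r = n + 1) (h' : q + r = n)
    (G : (Fin (q + 1) → V) → V [⋀^Fin r]→ₗ[R] M) (u : Fin n → V)
    (hG : ∀ (j : Fin (q + 1)) w x, G (j.insertNth w x) = (-1 : ℤ) ^ (j : ℕ) • G (Fin.cons w x)) :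
    ∃ Λ : V →ₗ[R] M, ∀ w, shuffleSum h (fun x y => G x y) (Fin.cons w u) =
      (q + 1) • shuffleSum h' (fun x y => G (Fin.cons w x) y) u + Λ w := by
  have key := fun w => sum_firstBlock_insertNth h h' (fun x y => G x y) w u
    fun j x y => by rw [hG, AlternatingMap.smul_apply]
  cases r with
  | zero =>
    refine ⟨0, fun w => ?_⟩
    rw [shuffleSum_cons_eq_sum, key]
    simp
  | succ r =>
    have h'' : q + 1 + r = n := by omega
    let L : Equiv.Perm (Fin n) → V →ₗ[R] M := fun τ =>
      { toFun := fun w => (G (firstBlock h'' (u ∘ τ))).curryLeft w (lastBlock h'' (u ∘ τ))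
        map_add' := fun w w' => by rw [map_add, AlternatingMap.add_apply]
        map_smul' := fun a w => by rw [map_smul, AlternatingMap.smul_apply, RingHom.id_apply] }
    refine ⟨(-1 : ℤ) ^ (q + 1) • (r + 1) • ∑ τ, (Equiv.Perm.sign τ : ℤ) • L τ, fun w => ?_⟩
    rw [shuffleSum_cons_eq_sum, key, sum_lastBlock_insertNth h h'' _ w u
      fun j x y => (G x).map_insertNth j w y]
    simp only [LinearMap.smul_apply, LinearMap.sum_apply]
    rfl

/-- The permutation acting separately on the first `q` and the last `r` letters. -/
def blockPerm (α : Equiv.Perm (Fin q)) (β : Equiv.Perm (Fin r)) : Equiv.Perm (Fin (q + r)) :=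
  finSumFinEquiv.permCongr (Equiv.Perm.sumCongr α β)

@[simp]
theorem blockPerm_castAdd (α : Equiv.Perm (Fin q)) (β : Equiv.Perm (Fin r)) (i : Fin q) :
    blockPerm α β (Fin.castAdd r i) = Fin.castAdd r (α i) := by
  simp [blockPerm, Equiv.permCongr_apply]

@[simp]
theorem blockPerm_natAdd (α : Equiv.Perm (Fin q)) (β : Equiv.Perm (Fin r)) (j : Fin r) :
    blockPerm α β (Fin.natAdd q j) = Fin.natAdd q (β j) := by
  simp [blockPerm, Equiv.permCongr_apply]

theorem sign_blockPerm (α : Equiv.Perm (Fin q)) (β : Equiv.Perm (Fin r)) :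
    Equiv.Perm.sign (blockPerm α β) = Equiv.Perm.sign α * Equiv.Perm.sign β := by
  rw [blockPerm, Equiv.Perm.sign_permCongr, Equiv.Perm.sign_sumCongr]

/-- A strictly increasing map is determined by its range, and precomposition with a permutation
keeps the range. This gives uniqueness of the unshuffle in a coset of block permutations. -/
theorem eq_one_of_strictMono_comp {m : ℕ} {α : Equiv.Perm (Fin m)} {f g : Fin m → Fin n}
    (hf : StrictMono f) (hg : StrictMono g) (h : f ∘ α = g) : α = 1 ∧ f = g := by
  have hfg : f = g := (StrictMono.range_inj hf hg).mp (by rw [← h, α.surjective.range_comp])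
  refine ⟨Equiv.ext fun i => hf.injective ?_, hfg⟩
  rw [Equiv.Perm.one_apply, ← Function.comp_apply (f := f), h, hfg]

theorem exists_perm_strictMono {m : ℕ} {f : Fin m → Fin n} (hf : Function.Injective f) :
    ∃ α : Equiv.Perm (Fin m), StrictMono (f ∘ α) :=
  ⟨Tuple.sort f, (Tuple.monotone_sort f).strictMono_of_injective
    (hf.comp (Tuple.sort f).injective)⟩

theorem mem_unshuffles {σ : Equiv.Perm (Fin (q + r))} :
    σ ∈ unshuffles q r ↔ StrictMono (σ ∘ Fin.castAdd r) ∧ StrictMono (σ ∘ Fin.natAdd q) := by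
  simp only [unshuffles, Finset.mem_filter, Finset.mem_univ, true_and]
  exact Iff.rfl

/-- A function on permutations that is invariant under permutations within the blocks is determined
by its values on unshuffles. -/
theorem sum_perm_eq_sum_unshuffles (F : Equiv.Perm (Fin (q + r)) → M)
    (hF : ∀ σ α β, F (σ * blockPerm α β) = F σ) :
    ∑ σ, F σ = (q.factorial * r.factorial) • ∑ σ ∈ unshuffles q r, F σ := by
  -- Every permutation is uniquely an unshuffle times a block permutation: sort its values on each
  -- block.
  have h : ∑ x ∈ unshuffles q r ×ˢ (Finset.univ : Finset (Equiv.Perm (Fin q) × Equiv.Perm (Fin r))),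
      F x.1 = ∑ σ, F σ := by
    refine Finset.sum_bij (fun x _ => x.1 * blockPerm x.2.1 x.2.2) (fun _ _ => Finset.mem_univ _)
      ?_ ?_ (fun x _ => (hF _ _ _).symm)
    · rintro ⟨σ, α, β⟩ hx ⟨σ', α', β'⟩ hx' he
      simp only [Finset.mem_product, Finset.mem_univ, and_true, mem_unshuffles] at hx hx' he
      have key : ∀ {s : ℕ} (i : Fin s → Fin (q + r)) (γ γ' : Equiv.Perm (Fin s)),
          (∀ t, blockPerm α β (i t) = i (γ t)) → (∀ t, blockPerm α' β' (i t) = i (γ' t)) →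
          StrictMono (σ ∘ i) → StrictMono (σ' ∘ i) → γ = γ' ∧ σ ∘ i = σ' ∘ i := by
        intro s i γ γ' h h' hσ hσ'
        have e : (σ ∘ i) ∘ (γ * γ'⁻¹ : Equiv.Perm (Fin s)) = σ' ∘ i := by
          funext t
          have := Equiv.congr_fun he (i (γ'⁻¹ t))
          simpa [h, h'] using this
        obtain ⟨h1, h2⟩ := eq_one_of_strictMono_comp hσ hσ' e
        exact ⟨mul_inv_eq_one.mp h1, h2⟩
      obtain ⟨rfl, h1⟩ := key (Fin.castAdd r) α α' (fun _ => blockPerm_castAdd _ _ _)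
        (fun _ => blockPerm_castAdd _ _ _) hx.1 hx'.1
      obtain ⟨rfl, -⟩ := key (Fin.natAdd q) β β' (fun _ => blockPerm_natAdd _ _ _)
        (fun _ => blockPerm_natAdd _ _ _) hx.2 hx'.2
      rw [mul_right_cancel he]
    · intro σ _
      obtain ⟨α, hα⟩ := exists_perm_strictMono (f := σ ∘ Fin.castAdd r)
        (σ.injective.comp (Fin.castAdd_injective q r))
      obtain ⟨β, hβ⟩ := exists_perm_strictMono (f := σ ∘ Fin.natAdd q)
        (σ.injective.comp (Fin.natAdd_injective r q))
      refine ⟨(σ * blockPerm α β, α⁻¹, β⁻¹), ?_, ?_⟩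
      · simp only [Finset.mem_product, Finset.mem_univ, and_true, mem_unshuffles]
        constructor
        · convert hα using 1
          funext i
          simp
        · convert hβ using 1
          funext i
          simp
      · have : blockPerm α β * blockPerm α⁻¹ β⁻¹ = 1 := by
          ext i
          refine Fin.addCases (fun i => ?_) (fun i => ?_) i <;> simp
        rw [mul_assoc, this, mul_one]
  rw [← h, Finset.sum_product, Finset.smul_sum]
  refine Finset.sum_congr rfl fun σ _ => ?_
  simp [Fintype.card_perm]

/-- If `G` is skew in each block, the summand is constant on cosets of block permutations, since
each block sign occurs twice. -/
theorem shuffleSum_eq_sum_unshuffles (h : q + r = n) (G : (Fin q → V) → (Fin r → V) → M)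
    (hG₁ : ∀ (α : Equiv.Perm (Fin q)) x y, G (x ∘ α) y = (Equiv.Perm.sign α : ℤ) • G x y)
    (hG₂ : ∀ (α : Equiv.Perm (Fin r)) x y, G x (y ∘ α) = (Equiv.Perm.sign α : ℤ) • G x y)
    (v : Fin n → V) :
    shuffleSum h G v = (q.factorial * r.factorial) •
      ∑ σ ∈ unshuffles q r, (Equiv.Perm.sign σ : ℤ) •
        G (fun i => v (Fin.cast h (σ (Fin.castAdd r i))))
          (fun j => v (Fin.cast h (σ (Fin.natAdd q j)))) := by
  subst h
  refine sum_perm_eq_sum_unshuffles _ fun σ α β => ?_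
  have e₁ : firstBlock rfl (v ∘ (σ * blockPerm α β : Equiv.Perm (Fin (q + r)))) =
      firstBlock rfl (v ∘ σ) ∘ α := by
    funext i
    simp [firstBlock]
  have e₂ : lastBlock rfl (v ∘ (σ * blockPerm α β : Equiv.Perm (Fin (q + r)))) =
      lastBlock rfl (v ∘ σ) ∘ β := by
    funext i
    simp [lastBlock]
  rw [e₁, e₂, hG₁, hG₂, smul_smul, smul_smul, Equiv.Perm.sign_mul, sign_blockPerm]
  congr 1
  push_cast
  have h₁ := Int.units_coe_mul_self (Equiv.Perm.sign α)
  have h₂ := Int.units_coe_mul_self (Equiv.Perm.sign β)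
  linear_combination (Equiv.Perm.sign σ : ℤ) * (Equiv.Perm.sign β : ℤ) ^ 2 * h₁ +
    (Equiv.Perm.sign σ : ℤ) * h₂

end ShuffleSum

/-! ### Alternating maps on tuples and vanishing on generators -/

section Tuples

variable {R V M : Type*} [CommRing R] [AddCommGroup V] [AddCommGroup M] [Module R V] [Module R M]
  {n : ℕ}

theorem AlternatingMap.map_snoc_eq_map_cons (f : V [⋀^Fin (n + 1)]→ₗ[R] M) (v : Fin n → V) (w : V) :
    f (Fin.snoc v w) = (-1 : ℤ) ^ n • f (Fin.cons w v) := by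
  rw [← Fin.insertNth_last', f.map_insertNth]
  rfl

theorem AlternatingMap.map_cons_cons (f : V [⋀^Fin (n + 2)]→ₗ[R] M) (z w : V) (y : Fin n → V) :
    f (Fin.cons z (Fin.cons w y)) = -f (Fin.cons w (Fin.cons z y)) := by
  have h : (Fin.cons z (Fin.cons w y) : Fin (n + 2) → V) =
      (1 : Fin (n + 2)).insertNth w (Fin.cons z y : Fin (n + 1) → V) := by
    refine eq_insertNth_of_forall rfl fun i => ?_
    refine Fin.cases rfl (fun i => ?_) i
    have : (1 : Fin (n + 2)).succAbove i.succ = i.succ.succ :=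
      Fin.succAbove_of_lt_succ _ _ (by simp [Fin.lt_def])
    rw [this]
    rfl
  rw [h, f.map_insertNth]
  simp [Matrix.vecCons]

theorem AlternatingMap.map_comp_perm (f : V [⋀^Fin n]→ₗ[R] M) (v : Fin n → V)
    (σ : Equiv.Perm (Fin n)) : f (v ∘ σ) = (Equiv.Perm.sign σ : ℤ) • f v :=
  f.map_perm v σ

theorem AlternatingMap.map_cons_comp_perm (f : V [⋀^Fin (n + 1)]→ₗ[R] M) (w : V) (x : Fin n → V)
    (σ : Equiv.Perm (Fin n)) :
    f (Fin.cons w (x ∘ σ)) = (Equiv.Perm.sign σ : ℤ) • f (Fin.cons w x) :=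
  (f.curryLeft w).map_comp_perm x σ

theorem AlternatingMap.map_cons_insertNth (f : V [⋀^Fin (n + 2)]→ₗ[R] M) (w z : V) (x : Fin n → V)
    (j : Fin (n + 1)) :
    f (Fin.cons w (j.insertNth z x)) = (-1 : ℤ) ^ (j : ℕ) • f (Fin.cons w (Fin.cons z x)) :=
  (f.curryLeft w).map_insertNth j z x

theorem AlternatingMap.map_cons_add (f : V [⋀^Fin (n + 1)]→ₗ[R] M) (w w' : V) (x : Fin n → V) :
    f (Fin.cons (w + w') x) = f (Fin.cons w x) + f (Fin.cons w' x) :=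
  congrArg (fun g => g x) (f.curryLeft.map_add w w')

theorem AlternatingMap.map_cons_smul (f : V [⋀^Fin (n + 1)]→ₗ[R] M) (a : R) (w : V)
    (x : Fin n → V) : f (Fin.cons (a • w) x) = a • f (Fin.cons w x) :=
  congrArg (fun g => g x) (f.curryLeft.map_smul a w)

theorem AlternatingMap.map_cons_zsmul (f : V [⋀^Fin (n + 1)]→ₗ[R] M) (a : ℤ) (w : V)
    (x : Fin n → V) : f (Fin.cons (a • w) x) = a • f (Fin.cons w x) :=
  congrArg (fun g => g x) (map_zsmul f.curryLeft a w)

theorem AlternatingMap.map_cons_neg (f : V [⋀^Fin (n + 1)]→ₗ[R] M) (w : V)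
    (x : Fin n → V) : f (Fin.cons (-w) x) = -f (Fin.cons w x) :=
  congrArg (fun g => g x) (map_neg f.curryLeft w)

theorem AlternatingMap.map_cons_sub (f : V [⋀^Fin (n + 1)]→ₗ[R] M) (w w' : V) (x : Fin n → V) :
    f (Fin.cons (w - w') x) = f (Fin.cons w x) - f (Fin.cons w' x) :=
  congrArg (fun g => g x) (map_sub f.curryLeft w w')

/-- An additive function of `n` arguments that is homogeneous and vanishes on generators is zero. -/
theorem eq_zero_of_span_eq_top {s : Set V} (hs : Submodule.span R s = ⊤) (F : (Fin n → V) → M)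
    (hadd : ∀ v i x y, F (Function.update v i (x + y)) =
      F (Function.update v i x) + F (Function.update v i y))
    (hsmul : ∀ v i (a : R) x, F (Function.update v i (a • x)) = a • F (Function.update v i x))
    (hzero : ∀ v, (∀ i, v i ∈ s) → F v = 0) (v : Fin n → V) : F v = 0 := by
  -- `t` is the set of positions whose entry need not be a generator; span induction frees one
  -- position at a time.
  have key : ∀ (t : Finset (Fin n)) (v : Fin n → V), (∀ i ∉ t, v i ∈ s) → F v = 0 := by
    intro t
    induction t using Finset.induction_on with
    | empty => exact fun v hv => hzero v fun i => hv i (Finset.notMem_empty i)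
    | insert i t hi ih =>
      intro v hv
      have h : ∀ x : V, F (Function.update v i x) = 0 := by
        intro x
        have hx : x ∈ Submodule.span R s := hs ▸ Submodule.mem_top
        induction hx using Submodule.span_induction with
        | mem x hx =>
          refine ih _ fun j hj => ?_
          by_cases hji : j = i
          · subst hji; simpa using hx
          · rw [Function.update_of_ne hji]
            exact hv j (by simp [hji, hj])
        | zero => simpa using hsmul v i 0 0
        | add x y _ _ hx hy => rw [hadd, hx, hy, add_zero]
        | smul a x _ hx => rw [hsmul, hx, smul_zero]
      simpa using h (v i)
  exact key Finset.univ v fun i hi => absurd (Finset.mem_univ i) hi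

/-- A skew-symmetric function that is linear in the first argument and vanishes on generators is
zero. -/
theorem eq_zero_of_span_eq_top_of_skew {s : Set V} (hs : Submodule.span R s = ⊤)
    (F : (Fin (n + 1) → V) → M)
    (hskew : ∀ v (π : Equiv.Perm (Fin (n + 1))), F (v ∘ π) = (Equiv.Perm.sign π : ℤ) • F v)
    (hadd : ∀ x y u, F (Fin.cons (x + y) u) = F (Fin.cons x u) + F (Fin.cons y u))
    (hsmul : ∀ (a : R) x u, F (Fin.cons (a • x) u) = a • F (Fin.cons x u))
    (hzero : ∀ v, (∀ i, v i ∈ s) → F v = 0) (v : Fin (n + 1) → V) : F v = 0 := by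
  -- Skewness moves position `i` to the front, with a sign independent of `x`, so linearity in the
  -- first slot gives linearity in every slot.
  have h : ∀ (v : Fin (n + 1) → V) i, ∃ u, ∀ x, F (Function.update v i x) =
      (Equiv.Perm.sign (Equiv.swap 0 i) : ℤ) • F (Fin.cons x u) := by
    intro v i
    refine ⟨Fin.tail (v ∘ Equiv.swap 0 i), fun x => ?_⟩
    rw [← hskew]
    congr 1
    funext j
    rcases eq_or_ne j i with rfl | hj
    · simp
    · rw [Function.update_of_ne hj, Function.comp_apply]
      have h0 : Equiv.swap 0 i j ≠ 0 := fun h => hj (by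
        have := congrArg (Equiv.swap 0 i) h
        simpa using this)
      obtain ⟨l, hl⟩ := Fin.exists_succ_eq.mpr h0
      rw [← hl, Fin.cons_succ, Fin.tail, hl]
      simp
  refine eq_zero_of_span_eq_top hs F (fun v i x y => ?_) (fun v i a x => ?_) hzero v
  · obtain ⟨u, hu⟩ := h v i
    rw [hu, hu, hu, hadd, smul_add]
  · obtain ⟨u, hu⟩ := h v i
    rw [hu, hu, hsmul, smul_comm]

end Tuples

/-! ### Tensoriality of the jacobiator and of the anchor defect -/

section Jacobiator

variable {k A V : Type*} [Field k] [CommRing A] [Algebra k A] [AddCommGroup V] [Module A V] {p : ℕ}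

/-- The anchor as a function of the module arguments. -/
def anchorAt (ρ : V [⋀^Fin (p + 1)]→ₗ[A] (A →ₗ[k] A)) (f : A) : V [⋀^Fin (p + 1)]→ₗ[A] A :=
  LinearMap.compAlternatingMap
    { toFun := fun φ : A →ₗ[k] A => φ f
      map_add' := fun _ _ => rfl
      map_smul' := fun _ _ => rfl } ρ

theorem anchorAt_apply (ρ : V [⋀^Fin (p + 1)]→ₗ[A] (A →ₗ[k] A)) (f : A) (v : Fin (p + 1) → V) :
    anchorAt ρ f v = ρ v f :=
  rfl

/-- The signed sum of `ρ (vₘ, …, v₂ₘ₋₂, ρ (v₁, …, vₘ₋₁, f))` over all permutations. -/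
def anchorAnchorSum (ρ : V [⋀^Fin (p + 1)]→ₗ[A] (A →ₗ[k] A)) (f : A) :
    (Fin (2 * p + 1 + 1) → V) → A :=
  shuffleSum (q := p + 1) (r := p + 1) (by omega) fun x y => anchorAt ρ (anchorAt ρ f x) y

theorem exists_anchorAnchorSum_cons (ρ : V [⋀^Fin (p + 1)]→ₗ[A] (A →ₗ[k] A)) (f : A) (u : Fin (2 * p + 1) → V) :
    ∃ Λ : V →ₗ[A] A, ∀ w, anchorAnchorSum ρ f (Fin.cons w u) =
      (p + 1) • shuffleSum (q := p) (r := p + 1) (by omega)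
        (fun x y => ρ y (ρ (Fin.cons w x) f)) u + Λ w :=
  exists_shuffleSum_cons_eq_add _ _ (fun x => anchorAt ρ (anchorAt ρ f x)) u fun j w x => by
    ext y
    rw [(anchorAt ρ f).map_insertNth, anchorAt_apply, map_zsmul]
    rfl

variable [Module k V]

/-- The signed sum of `[[v₁, …, vₘ], vₘ₊₁, …, v₂ₘ₋₁]` over all permutations of the arguments. -/
def jacobiator (β : V [⋀^Fin (p + 2)]→ₗ[k] V) : (Fin (2 * p + 2 + 1) → V) → V :=
  shuffleSum (q := p + 1 + 1) (r := p + 1) (by omega) fun x y => β (Fin.cons (β x) y)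

/-- The signed sum of `ρ ([v₁, …, vₘ], vₘ₊₁, …, v₂ₘ₋₂, f)` over all permutations. -/
def anchorBracketSum (β : V [⋀^Fin (p + 2)]→ₗ[k] V) (ρ : V [⋀^Fin (p + 1)]→ₗ[A] (A →ₗ[k] A))
    (f : A) : (Fin (2 * p + 1 + 1) → V) → A :=
  shuffleSum (q := p + 1 + 1) (r := p) (by omega) fun x y => (anchorAt ρ f).curryLeft (β x) y

/-- The defect of the compatibility of the anchor with the bracket. -/
def anchorDefect (β : V [⋀^Fin (p + 2)]→ₗ[k] V) (ρ : V [⋀^Fin (p + 1)]→ₗ[A] (A →ₗ[k] A))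
    (f : A) (v : Fin (2 * p + 1 + 1) → V) : A :=
  (p + 1) • anchorBracketSum β ρ f v + (p + 2) • anchorAnchorSum ρ f v

variable {β : V [⋀^Fin (p + 2)]→ₗ[k] V} {ρ : V [⋀^Fin (p + 1)]→ₗ[A] (A →ₗ[k] A)}

/-- Moving an entry from the last slot to the first costs (-1)^(p+1) = -1, which turns the sign of
the anchor term. -/
theorem bracket_cons_smul (hp : Even p)
    (hβ : ∀ (v : Fin (p + 1) → V) (a : A) (w : V),
      β (Fin.snoc v (a • w)) = a • β (Fin.snoc v w) + ρ v a • w)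
    (v : Fin (p + 1) → V) (a : A) (w : V) :
    β (Fin.cons (a • w) v) = a • β (Fin.cons w v) - ρ v a • w := by
  have h := hβ v a w
  simp only [β.map_snoc_eq_map_cons, hp.add_one.neg_one_pow, neg_smul, one_smul, smul_neg] at h
  rw [← neg_inj, h]
  module

theorem anchorDefect_comp_perm (f : A) (v : Fin (2 * p + 1 + 1) → V)
    (π : Equiv.Perm (Fin (2 * p + 1 + 1))) :
    anchorDefect β ρ f (v ∘ π) = (Equiv.Perm.sign π : ℤ) • anchorDefect β ρ f v := by
  simp only [anchorDefect, anchorBracketSum, anchorAnchorSum, shuffleSum_comp_perm, smul_add,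
    smul_comm (_ : ℤ) (_ : ℕ)]

theorem exists_anchorBracketSum_cons (f : A) (u : Fin (2 * p + 1) → V) :
    ∃ Λ : V →ₗ[A] A, ∀ w, anchorBracketSum β ρ f (Fin.cons w u) =
      (p + 2) • shuffleSum (q := p + 1) (r := p) (by omega)
        (fun x y => ρ (Fin.cons (β (Fin.cons w x)) y) f) u + Λ w :=
  exists_shuffleSum_cons_eq_add _ _ (fun x => (anchorAt ρ f).curryLeft (β x)) u fun j w x => by
    rw [β.map_insertNth, map_zsmul]
    rfl

theorem anchorDefect_cons_add (f : A) (w w' : V) (u : Fin (2 * p + 1) → V) :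
    anchorDefect β ρ f (Fin.cons (w + w') u) =
      anchorDefect β ρ f (Fin.cons w u) + anchorDefect β ρ f (Fin.cons w' u) := by
  obtain ⟨Λ₁, h₁⟩ := exists_anchorBracketSum_cons (β := β) (ρ := ρ) f u
  obtain ⟨Λ₂, h₂⟩ := exists_anchorAnchorSum_cons ρ f u
  simp only [anchorDefect, h₁, h₂, AlternatingMap.map_cons_add, map_add, LinearMap.add_apply,
    shuffleSum_add]
  module

/-- Only terms with `w` inside the inner bracket or inner anchor are not visibly linear. The Leibniz
rules yield -T and +T there, where T sums ρ(w, y; f) ρ(x; g), both with total weight (p + 1)(p + 2);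
exchanging blocks of sizes p and p + 1 costs no sign. -/
theorem anchorDefect_cons_smul (hp : Even p)
    (hβ : ∀ (v : Fin (p + 1) → V) (a : A) (w : V),
      β (Fin.snoc v (a • w)) = a • β (Fin.snoc v w) + ρ v a • w)
    (hρ : ∀ (v : Fin (p + 1) → V) (a b : A), ρ v (a * b) = a * ρ v b + b * ρ v a)
    (f g : A) (w : V) (u : Fin (2 * p + 1) → V) :
    anchorDefect β ρ f (Fin.cons (g • w) u) = g * anchorDefect β ρ f (Fin.cons w u) := by
  obtain ⟨Λ₁, h₁⟩ := exists_anchorBracketSum_cons (β := β) (ρ := ρ) f u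
  obtain ⟨Λ₂, h₂⟩ := exists_anchorAnchorSum_cons ρ f u
  have hs : shuffleSum (q := p) (r := p + 1) (n := 2 * p + 1) (by omega)
      (fun x y => ρ (Fin.cons w x) f * ρ y g) u =
      shuffleSum (q := p + 1) (r := p) (by omega)
      (fun x y => ρ (Fin.cons w y) f * ρ x g) u := by
    rw [shuffleSum_swap_blocks (q := p + 1) (r := p) (by omega) (by omega)
      (fun x y => ρ (Fin.cons w y) f * ρ x g), Even.neg_one_pow (hp.mul_left _), one_smul]
  have e₁ : shuffleSum (q := p + 1) (r := p) (n := 2 * p + 1) (by omega)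
        (fun x y => ρ (Fin.cons (β (Fin.cons (g • w) x)) y) f) u =
      g • shuffleSum (q := p + 1) (r := p) (by omega)
        (fun x y => ρ (Fin.cons (β (Fin.cons w x)) y) f) u +
      -shuffleSum (q := p + 1) (r := p) (by omega)
        (fun x y => ρ (Fin.cons w y) f * ρ x g) u := by
    rw [← shuffleSum_neg, ← shuffleSum_smul, ← shuffleSum_add]
    refine shuffleSum_congr _ (fun x y => ?_) u
    rw [bracket_cons_smul hp hβ, ρ.map_cons_sub, ρ.map_cons_smul, ρ.map_cons_smul]
    simp only [LinearMap.sub_apply, LinearMap.smul_apply, smul_eq_mul]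
    ring
  have e₂ : shuffleSum (q := p) (r := p + 1) (n := 2 * p + 1) (by omega)
        (fun x y => ρ y (ρ (Fin.cons (g • w) x) f)) u =
      g • shuffleSum (q := p) (r := p + 1) (by omega)
        (fun x y => ρ y (ρ (Fin.cons w x) f)) u +
      shuffleSum (q := p) (r := p + 1) (by omega)
        (fun x y => ρ (Fin.cons w x) f * ρ y g) u := by
    rw [← shuffleSum_smul, ← shuffleSum_add]
    refine shuffleSum_congr _ (fun x y => ?_) u
    rw [ρ.map_cons_smul, LinearMap.smul_apply, smul_eq_mul, hρ, smul_eq_mul]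
  simp only [anchorDefect, h₁, h₂, e₁, e₂, hs, map_smul, smul_eq_mul, nsmul_eq_mul]
  push_cast
  ring

theorem jacobiator_comp_perm (v : Fin (2 * p + 2 + 1) → V)
    (π : Equiv.Perm (Fin (2 * p + 2 + 1))) :
    jacobiator β (v ∘ π) = (Equiv.Perm.sign π : ℤ) • jacobiator β v :=
  shuffleSum_comp_perm _ _ _ _

theorem jacobiator_cons (hp : Even p) (w : V) (u : Fin (2 * p + 2) → V) :
    jacobiator β (Fin.cons w u) =
      (p + 2) • shuffleSum (q := p + 1) (r := p + 1) (by omega)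
        (fun x y => β (Fin.cons (β (Fin.cons w x)) y)) u +
      (p + 1) • shuffleSum (q := p + 2) (r := p) (by omega)
        (fun x y => β (Fin.cons (β x) (Fin.cons w y))) u := by
  rw [jacobiator, shuffleSum_cons _ (by omega) (by omega), hp.add_one.add_one.neg_one_pow,
    one_smul]
  · intro j x y
    rw [β.map_insertNth, β.map_cons_zsmul]
    rfl
  · intro j x y
    rw [β.map_cons_insertNth]

theorem jacobiator_cons_add (hp : Even p) (w w' : V) (u : Fin (2 * p + 2) → V) :
    jacobiator β (Fin.cons (w + w') u) =
      jacobiator β (Fin.cons w u) + jacobiator β (Fin.cons w' u) := by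
  have h : ∀ (z : V) y, β (Fin.cons z (Fin.cons (w + w') y)) =
      β (Fin.cons z (Fin.cons w y)) + β (Fin.cons z (Fin.cons w' y)) :=
    fun z y => (β.curryLeft z).map_cons_add w w' y
  simp only [jacobiator_cons hp, h, AlternatingMap.map_cons_add, shuffleSum_add]
  module

/-- Expanding with the Leibniz rule, the two terms ρ(y; f) [w, x] and ρ(x; f) [w, y] cancel, since
exchanging two blocks of odd size p + 1 changes the sign. The surviving multiples of `w` have
weights p + 2 and p + 1 and assemble to the anchor defect. -/
theorem jacobiator_cons_smul (hp : Even p)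
    (hβ : ∀ (v : Fin (p + 1) → V) (a : A) (w : V),
      β (Fin.snoc v (a • w)) = a • β (Fin.snoc v w) + ρ v a • w)
    (f : A) (w : V) (u : Fin (2 * p + 2) → V) :
    jacobiator β (Fin.cons (f • w) u) =
      f • jacobiator β (Fin.cons w u) + anchorDefect β ρ f u • w := by
  have hs : shuffleSum (q := p + 1) (r := p + 1) (n := 2 * p + 2) (by omega)
      (fun x y => ρ y f • β (Fin.cons w x)) u =
      -shuffleSum (q := p + 1) (r := p + 1) (by omega)
      (fun x y => ρ x f • β (Fin.cons w y)) u := by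
    rw [shuffleSum_swap_blocks (q := p + 1) (r := p + 1) (by omega) (by omega)
      (fun x y => ρ x f • β (Fin.cons w y)), Odd.neg_one_pow (hp.add_one.mul hp.add_one),
      neg_smul, one_smul]
  have e₁ : shuffleSum (q := p + 1) (r := p + 1) (n := 2 * p + 2) (by omega)
        (fun x y => β (Fin.cons (β (Fin.cons (f • w) x)) y)) u =
      f • shuffleSum (q := p + 1) (r := p + 1) (by omega)
        (fun x y => β (Fin.cons (β (Fin.cons w x)) y)) u +
      -shuffleSum (q := p + 1) (r := p + 1) (n := 2 * p + 2) (by omega)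
        (fun x y => ρ y f • β (Fin.cons w x)) u +
      -shuffleSum (q := p + 1) (r := p + 1) (n := 2 * p + 2) (by omega)
        (fun x y => ρ x f • β (Fin.cons w y)) u +
      anchorAnchorSum ρ f u • w := by
    rw [anchorAnchorSum, ← shuffleSum_smul_const, ← shuffleSum_neg, ← shuffleSum_neg,
      ← shuffleSum_smul, ← shuffleSum_add, ← shuffleSum_add, ← shuffleSum_add]
    refine shuffleSum_congr _ (fun x y => ?_) u
    rw [bracket_cons_smul hp hβ, β.map_cons_sub, bracket_cons_smul hp hβ,
      bracket_cons_smul hp hβ]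
    simp only [anchorAt_apply]
    module
  have e₂ : shuffleSum (q := p + 2) (r := p) (n := 2 * p + 2) (by omega)
        (fun x y => β (Fin.cons (β x) (Fin.cons (f • w) y))) u =
      f • shuffleSum (q := p + 2) (r := p) (by omega)
        (fun x y => β (Fin.cons (β x) (Fin.cons w y))) u +
      anchorBracketSum β ρ f u • w := by
    rw [anchorBracketSum, ← shuffleSum_smul_const, ← shuffleSum_smul, ← shuffleSum_add]
    refine shuffleSum_congr _ (fun x y => ?_) u
    rw [β.map_cons_cons, bracket_cons_smul hp hβ, β.map_cons_cons w]
    change _ = _ + ρ (Fin.cons (β x) y) f • w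
    module
  simp only [jacobiator_cons hp, e₁, e₂, hs, anchorDefect]
  module

theorem anchorDefect_eq_zero_of_span {s : Set V} (hs : Submodule.span A s = ⊤) (hp : Even p)
    (hβ : ∀ (v : Fin (p + 1) → V) (a : A) (w : V),
      β (Fin.snoc v (a • w)) = a • β (Fin.snoc v w) + ρ v a • w)
    (hρ : ∀ (v : Fin (p + 1) → V) (a b : A), ρ v (a * b) = a * ρ v b + b * ρ v a) (f : A)
    (hzero : ∀ v, (∀ i, v i ∈ s) → anchorDefect β ρ f v = 0) (v : Fin (2 * p + 1 + 1) → V) :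
    anchorDefect β ρ f v = 0 :=
  eq_zero_of_span_eq_top_of_skew hs _ (anchorDefect_comp_perm f) (anchorDefect_cons_add f)
    (fun a x u => anchorDefect_cons_smul hp hβ hρ f a x u) hzero v

theorem jacobiator_eq_zero_of_span {s : Set V} (hs : Submodule.span A s = ⊤) (hp : Even p)
    (hβ : ∀ (v : Fin (p + 1) → V) (a : A) (w : V),
      β (Fin.snoc v (a • w)) = a • β (Fin.snoc v w) + ρ v a • w)
    (hρ : ∀ f v, anchorDefect β ρ f v = 0)
    (hzero : ∀ v, (∀ i, v i ∈ s) → jacobiator β v = 0) (v : Fin (2 * p + 2 + 1) → V) :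
    jacobiator β v = 0 :=
  eq_zero_of_span_eq_top_of_skew hs _ jacobiator_comp_perm (jacobiator_cons_add hp)
    (fun a x u => by rw [jacobiator_cons_smul hp hβ, hρ, zero_smul, add_zero]) hzero v

theorem sum_unshuffles_bracket_bracket [CharZero k] (hβ : ∀ v, jacobiator β v = 0)
    (v : Fin ((p + 2) + (p + 1)) → V) :
    ∑ σ ∈ unshuffles (p + 2) (p + 1), (Equiv.Perm.sign σ : ℤ) •
      β (Fin.cons (β fun i => v (σ (Fin.castAdd (p + 1) i)))
        fun j => v (σ (Fin.natAdd (p + 2) j))) = 0 := by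
  have e : 2 * p + 2 + 1 = p + 2 + (p + 1) := by omega
  have h := hβ (v ∘ Fin.cast e)
  rw [jacobiator, shuffleSum_eq_sum_unshuffles] at h
  · have hc : ((((p + 1 + 1).factorial * (p + 1).factorial : ℕ) : k)) ≠ 0 :=
      Nat.cast_ne_zero.mpr (mul_ne_zero (Nat.factorial_ne_zero _) (Nat.factorial_ne_zero _))
    rw [← Nat.cast_smul_eq_nsmul k] at h
    exact (smul_eq_zero.mp h).resolve_left hc
  · intro α x y
    rw [β.map_comp_perm, β.map_cons_zsmul]
  · intro α x y
    rw [β.map_cons_comp_perm]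

theorem sum_unshuffles_anchor [CharZero k] (hρ : ∀ f v, anchorDefect β ρ f v = 0)
    (v : Fin ((p + 1) + (p + 1)) → V) (a : A) :
    ∑ σ ∈ unshuffles (p + 2) p, (Equiv.Perm.sign σ : ℤ) •
        ρ (Fin.cons
          (β fun i => v (Fin.cast (by omega) (σ (Fin.castAdd p i))))
          fun j => v (Fin.cast (by omega) (σ (Fin.natAdd (p + 2) j)))) a
      + ∑ σ ∈ unshuffles (p + 1) (p + 1), (Equiv.Perm.sign σ : ℤ) •
        ρ (fun j => v (σ (Fin.natAdd (p + 1) j)))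
          (ρ (fun i => v (σ (Fin.castAdd (p + 1) i))) a) = 0 := by
  have e : 2 * p + 1 + 1 = p + 1 + (p + 1) := by omega
  have h := hρ a (v ∘ Fin.cast e)
  rw [anchorDefect, anchorBracketSum, anchorAnchorSum, shuffleSum_eq_sum_unshuffles,
    shuffleSum_eq_sum_unshuffles] at h
  · have hc : ((((p + 1 + 1).factorial * (p + 1).factorial : ℕ) : k)) ≠ 0 :=
      Nat.cast_ne_zero.mpr (mul_ne_zero (Nat.factorial_ne_zero _) (Nat.factorial_ne_zero _))
    -- The weights p + 1 and p + 2 in `anchorDefect` equalize the factorials of the two kinds of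
    -- unshuffles, so one common nonzero factor can be divided out.
    have h₁ : (p + 1) * ((p + 1 + 1).factorial * p.factorial) =
        (p + 1 + 1).factorial * (p + 1).factorial := by
      rw [Nat.factorial_succ p]; ring
    have h₂ : (p + 2) * ((p + 1).factorial * (p + 1).factorial) =
        (p + 1 + 1).factorial * (p + 1).factorial := by
      rw [Nat.factorial_succ (p + 1)]; ring
    rw [smul_smul, smul_smul, h₁, h₂, ← smul_add, ← Nat.cast_smul_eq_nsmul k] at h
    exact (smul_eq_zero.mp h).resolve_left hc
  · intro α x y
    rw [(anchorAt ρ a).map_comp_perm, anchorAt_apply, anchorAt_apply, anchorAt_apply, map_zsmul]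
  · intro α x y
    rw [AlternatingMap.map_comp_perm]
  · intro α x y
    rw [β.map_comp_perm, map_zsmul, AlternatingMap.smul_apply]
  · intro α x y
    rw [AlternatingMap.map_comp_perm]

end Jacobiator

/-! ### Lie derivatives of Kähler differentials -/

namespace KaehlerDifferential

variable {k A : Type*} [Field k] [CommRing A] [Algebra k A]

/-- Pairs of differentials, with `A` acting through the homomorphism `a ↦ a + X a ε` to the dual
numbers. -/
def TwistedPair (_X : Derivation k A A) : Type _ := Ω[A⁄k] × Ω[A⁄k]

namespace TwistedPair

variable (X : Derivation k A A)

noncomputable instance : AddCommGroup (TwistedPair X) :=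
  inferInstanceAs (AddCommGroup (Ω[A⁄k] × Ω[A⁄k]))

noncomputable instance : Module k (TwistedPair X) :=
  inferInstanceAs (Module k (Ω[A⁄k] × Ω[A⁄k]))

/-- Associativity of the action is the Leibniz rule for `X`. The twist makes b ↦ (db, d(X b)) a
derivation, so that the universal property produces a map that is not `A`-linear in the usual sense.
-/
noncomputable instance : Module A (TwistedPair X) where
  smul a x := (a • x.1, a • x.2 + X a • x.1)
  one_smul x := by
    refine Prod.ext (one_smul _ _) ?_
    change (1 : A) • x.2 + X 1 • x.1 = x.2
    simp
  mul_smul a b x := by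
    refine Prod.ext (mul_smul _ _ _) ?_
    change (a * b) • x.2 + X (a * b) • x.1 = a • (b • x.2 + X b • x.1) + X a • b • x.1
    rw [X.leibniz, smul_eq_mul, smul_eq_mul]
    module
  smul_zero a := by
    refine Prod.ext (smul_zero _) ?_
    change a • (0 : Ω[A⁄k]) + X a • (0 : Ω[A⁄k]) = 0
    simp
  smul_add a x y := by
    refine Prod.ext (smul_add _ _ _) ?_
    change a • (x.2 + y.2) + X a • (x.1 + y.1) = a • x.2 + X a • x.1 + (a • y.2 + X a • y.1)
    module
  add_smul a b x := by
    refine Prod.ext (add_smul _ _ _) ?_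
    change (a + b) • x.2 + X (a + b) • x.1 = a • x.2 + X a • x.1 + (b • x.2 + X b • x.1)
    rw [map_add]
    module
  zero_smul x := by
    refine Prod.ext (zero_smul _ _) ?_
    change (0 : A) • x.2 + X 0 • x.1 = 0
    simp

theorem smul_def (a : A) (x : TwistedPair X) : a • x = (a • x.1, a • x.2 + X a • x.1) := rfl

instance : IsScalarTower k A (TwistedPair X) where
  smul_assoc c a x := by
    refine Prod.ext (smul_assoc c a x.1) ?_
    change (c • a) • x.2 + X (c • a) • x.1 = c • (a • x.2 + X a • x.1)
    rw [X.map_smul, smul_assoc, smul_assoc, smul_add]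

/-- The derivation `b ↦ (db, d(X b))`. -/
noncomputable def derivation : Derivation k A (TwistedPair X) :=
  Derivation.mk'
    { toFun := fun b => (D k A b, D k A (X b))
      map_add' := fun b c => by simp only [map_add]; rfl
      map_smul' := fun t b => by simp only [Derivation.map_smul]; rfl }
    (fun b c => by
      change (D k A (b * c), D k A (X (b * c))) =
        (b • D k A c + c • D k A b,
          (b • D k A (X c) + X b • D k A c) + (c • D k A (X b) + X c • D k A b))
      simp only [Derivation.leibniz, smul_eq_mul, map_add]
      refine Prod.ext rfl ?_
      module)

end TwistedPair

/-- The Lie derivative on Kähler differentials along the derivation `X`. -/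
noncomputable def lieDerivative (X : Derivation k A A) : Ω[A⁄k] →ₗ[k] Ω[A⁄k] :=
  LinearMap.snd k Ω[A⁄k] Ω[A⁄k] ∘ₗ
    ((TwistedPair.derivation X).liftKaehlerDifferential.restrictScalars k :
      Ω[A⁄k] →ₗ[k] TwistedPair X)

theorem lieDerivative_D (X : Derivation k A A) (b : A) :
    lieDerivative X (D k A b) = D k A (X b) :=
  congrArg Prod.snd ((TwistedPair.derivation X).liftKaehlerDifferential_comp_D b)

theorem induction_smul_D {C : Ω[A⁄k] → Prop} (ω : Ω[A⁄k]) (hD : ∀ b, C (D k A b))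
    (hadd : ∀ ω η, C ω → C η → C (ω + η)) (hsmul : ∀ (a : A) ω, C ω → C (a • ω)) : C ω := by
  have hω : ω ∈ Submodule.span A (Set.range (D k A)) :=
    span_range_derivation k A ▸ Submodule.mem_top
  induction hω using Submodule.span_induction with
  | mem x hx => obtain ⟨b, rfl⟩ := hx; exact hD b
  | zero => simpa using hD 0
  | add x y _ _ hx hy => exact hadd x y hx hy
  | smul a x _ hx => exact hsmul a x hx

/-- This identifies the twisting term `X a • x.1` as `X a • ω`, giving the Leibniz rule of the Lie
derivative. -/
theorem fst_lift_derivation (X : Derivation k A A) (ω : Ω[A⁄k]) :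
    Prod.fst ((TwistedPair.derivation X).liftKaehlerDifferential ω : Ω[A⁄k] × Ω[A⁄k]) = ω := by
  induction ω using induction_smul_D with
  | hD b => rw [Derivation.liftKaehlerDifferential_comp_D]; rfl
  | hadd ω η h₁ h₂ => rw [map_add]; exact congrArg₂ (· + ·) h₁ h₂
  | hsmul a ω h => rw [map_smul]; exact congrArg (a • ·) h

theorem lieDerivative_smul (X : Derivation k A A) (a : A) (ω : Ω[A⁄k]) :
    lieDerivative X (a • ω) = a • lieDerivative X ω + X a • ω := by
  have h := congrArg Prod.snd ((TwistedPair.derivation X).liftKaehlerDifferential.map_smul a ω)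
  rw [TwistedPair.smul_def, fst_lift_derivation] at h
  exact h

theorem lieDerivative_add_left (X Y : Derivation k A A) (ω : Ω[A⁄k]) :
    lieDerivative (X + Y) ω = lieDerivative X ω + lieDerivative Y ω := by
  induction ω using induction_smul_D with
  | hD b => simp only [lieDerivative_D, Derivation.add_apply, map_add]
  | hadd ω η h₁ h₂ => simp only [map_add, h₁, h₂]; abel
  | hsmul a ω h => simp only [lieDerivative_smul, h, Derivation.add_apply]; module

/-- The Cartan-type correction ω(X) df, checked on exact differentials and propagated by the Leibniz
rule. -/
theorem lieDerivative_smul_left (X : Derivation k A A) (f : A) (ω : Ω[A⁄k]) :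
    lieDerivative (f • X) ω = f • lieDerivative X ω + X.liftKaehlerDifferential ω • D k A f := by
  induction ω using induction_smul_D with
  | hD b =>
    simp only [lieDerivative_D, Derivation.smul_apply, Derivation.liftKaehlerDifferential_comp_D,
      smul_eq_mul, Derivation.leibniz]
  | hadd ω η h₁ h₂ => simp only [map_add, h₁, h₂]; module
  | hsmul a ω h =>
    simp only [lieDerivative_smul, h, Derivation.smul_apply, map_smul, smul_eq_mul]; module

/-- The correction term vanishes because constants have zero differential. -/
theorem lieDerivative_field_smul_left (X : Derivation k A A) (c : k) (ω : Ω[A⁄k]) :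
    lieDerivative (c • X) ω = c • lieDerivative X ω := by
  have h := lieDerivative_smul_left X (algebraMap k A c) ω
  rw [Derivation.map_algebraMap, smul_zero, add_zero, algebraMap_smul, algebraMap_smul] at h
  exact h

/-! ### Multiderivations as multilinear forms on differentials -/

section Multiderivation

variable {M : Type*} [AddCommGroup M] [Module A M] {n : ℕ}

theorem eq_of_forall_D {F G : MultilinearMap A (fun _ : Fin n => Ω[A⁄k]) M}
    (h : ∀ a : Fin n → A, F (fun i => D k A (a i)) = G (fun i => D k A (a i))) : F = G := by
  ext v
  rw [← sub_eq_zero]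
  refine eq_zero_of_span_eq_top (span_range_derivation k A) (fun v => F v - G v) ?_ ?_ ?_ v
  · intro v i x y
    simp only [MultilinearMap.map_update_add]
    abel
  · intro v i a x
    simp only [MultilinearMap.map_update_smul, smul_sub]
  · intro v hv
    choose a ha using hv
    obtain rfl : (fun i => D k A (a i)) = v := funext ha
    exact sub_eq_zero.mpr (h a)

variable [Module k M] [IsScalarTower k A M]

/-- A multiderivation factors through the universal derivation. -/
theorem exists_multilinearMap_D (f : MultilinearMap k (fun _ : Fin n => A) M)
    (hf : ∀ v i b c, f (Function.update v i (b * c)) =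
      b • f (Function.update v i c) + c • f (Function.update v i b)) :
    ∃ F : MultilinearMap A (fun _ : Fin n => Ω[A⁄k]) M, ∀ a, F (fun i => D k A (a i)) = f a := by
  induction n with
  | zero => exact ⟨MultilinearMap.constOfIsEmpty A _ (f 0), fun a => congrArg f (Subsingleton.elim _ _)⟩
  | succ n ih =>
    have h : ∀ a, ∃ F : MultilinearMap A (fun _ : Fin n => Ω[A⁄k]) M,
        ∀ b, F (fun i => D k A (b i)) = f.curryLeft a b := fun a => ih _ fun v i b c => by
      simp only [MultilinearMap.curryLeft_apply, Fin.cons_update, hf]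
    choose F hF using h
    have hFb : ∀ a b, F a (fun i => D k A (b i)) = f (Fin.cons a b) := hF
    have hcons : ∀ (a : A) (b : Fin n → A), (Fin.cons a b : Fin (n + 1) → A) =
        Function.update (Fin.cons 0 b : Fin (n + 1) → A) 0 a :=
      fun a b => (Fin.update_cons_zero _ _ _).symm
    have : IsScalarTower k A (MultilinearMap A (fun _ : Fin n => Ω[A⁄k]) M) :=
      ⟨fun c a F => by ext v; exact smul_assoc c a (F v)⟩
    -- With the other n slots already factored, the first slot is a derivation valued in multilinear
    -- forms; the universal property applies once more.
    let δ : Derivation k A (MultilinearMap A (fun _ : Fin n => Ω[A⁄k]) M) :=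
      Derivation.mk'
        { toFun := F
          map_add' := fun a a' => eq_of_forall_D fun b => by
            simp only [add_apply, hF, map_add]
          map_smul' := fun c a => eq_of_forall_D fun b => by
            simp only [smul_apply, hF, map_smul, RingHom.id_apply] }
        (fun a a' => eq_of_forall_D fun b => by
          change F _ _ = a • F a' _ + a' • F a _
          rw [hFb, hFb, hFb, hcons, hf, hcons a, hcons a'])
    refine ⟨δ.liftKaehlerDifferential.uncurryLeft, fun a => ?_⟩
    change δ.liftKaehlerDifferential (D k A (a 0)) (fun i => D k A (a i.succ)) = f a
    rw [Derivation.liftKaehlerDifferential_comp_D]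
    change F _ _ = _
    rw [hFb]
    exact congrArg f (Fin.cons_self_tail a)

/-- An alternating multiderivation factors through the universal derivation. -/
theorem exists_alternatingMap_D [CharZero k] (f : A [⋀^Fin n]→ₗ[k] M)
    (hf : ∀ v i b c, f (Function.update v i (b * c)) =
      b • f (Function.update v i c) + c • f (Function.update v i b)) :
    ∃ F : Ω[A⁄k] [⋀^Fin n]→ₗ[A] M, ∀ a, F (fun i => D k A (a i)) = f a := by
  obtain ⟨F, hF⟩ := exists_multilinearMap_D f.toMultilinearMap hf
  refine ⟨{ F with map_eq_zero_of_eq' := fun v i j hij hne => ?_ }, hF⟩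
  -- Equality of two entries cannot be tested on generators, but antisymmetry can; it implies
  -- alternation as 2 is invertible.
  have h : F.domDomCongr (Equiv.swap i j) = -F := eq_of_forall_D fun a => by
    change F (fun l => D k A ((a ∘ Equiv.swap i j) l)) = -F _
    rw [hF, hF]
    exact f.map_swap a hne
  have h2 : F (v ∘ Equiv.swap i j) = -F v := congrArg (fun G => G v) h
  have h3 : v ∘ Equiv.swap i j = v := by
    rw [Equiv.comp_swap_eq_update, hij, Function.update_eq_self, ← hij, Function.update_eq_self]
  rw [h3, eq_neg_iff_add_eq_zero, ← two_smul k] at h2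
  exact (smul_eq_zero.mp h2).resolve_left two_ne_zero

end Multiderivation

end KaehlerDifferential

/-! ### Auxiliary sign rules -/

theorem shuffleSum_comp_first {V M : Type*} [AddCommGroup M] {n q r : ℕ} (h : q + r = n)
    (G : (Fin q → V) → (Fin r → V) → M) (v : Fin n → V) (α : Equiv.Perm (Fin q)) :
    shuffleSum h (fun x y => G (x ∘ α) y) v = (Equiv.Perm.sign α : ℤ) • shuffleSum h G v := by
  subst h
  have hs : Equiv.Perm.sign (blockPerm (r := r) α 1) = Equiv.Perm.sign α := by
    rw [sign_blockPerm, map_one, mul_one]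
  rw [← hs, shuffleSum, shuffleSum,
    ← sum_sign_smul_comp_perm (fun x => G (firstBlock rfl x) (lastBlock rfl x))]
  refine Finset.sum_congr rfl fun σ _ => ?_
  congr 2
  · funext i
    simp [firstBlock]
  · funext i
    simp [lastBlock]

theorem neg_one_pow_smul_self_smul {M : Type*} [AddCommGroup M] (i : ℕ) (x : M) :
    (-1 : ℤ) ^ i • (-1 : ℤ) ^ i • x = x := by
  rw [smul_smul, ← pow_add, Even.neg_one_pow ⟨_, rfl⟩, one_smul]

theorem KaehlerDifferential.forall_of_mem_range_D {k A : Type*} [Field k] [CommRing A]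
    [Algebra k A] {n : ℕ} {C : (Fin n → Ω[A⁄k]) → Prop}
    (h : ∀ a : Fin n → A, C fun i => KaehlerDifferential.D k A (a i)) (v : Fin n → Ω[A⁄k])
    (hv : ∀ i, v i ∈ Set.range (KaehlerDifferential.D k A)) : C v := by
  choose a ha using hv
  obtain rfl : (fun i => KaehlerDifferential.D k A (a i)) = v := funext ha
  exact h a

theorem AlternatingMap.map_snoc_removeNth {R V M : Type*} [CommRing R] [AddCommGroup V]
    [AddCommGroup M] [Module R V] [Module R M] {n : ℕ} (f : V [⋀^Fin (n + 1)]→ₗ[R] M)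
    (i : Fin (n + 1)) (v : Fin (n + 1) → V) :
    f (Fin.snoc (i.removeNth v) (v i)) = (-1 : ℤ) ^ n • (-1 : ℤ) ^ (i : ℕ) • f v := by
  rw [f.map_snoc_eq_map_cons]
  congr 1
  conv_rhs => rw [← Fin.insertNth_self_removeNth i v]
  exact (f.neg_one_pow_smul_map_insertNth i (v i) (i.removeNth v)).symm

/-- Restriction of scalars of an alternating map. -/
def AlternatingMap.restrictBase {A V M : Type*} (k : Type*) [CommRing k] [CommRing A] [Algebra k A]
    [AddCommGroup V] [AddCommGroup M] [Module A V] [Module A M] [Module k V] [Module k M]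
    [IsScalarTower k A V] [IsScalarTower k A M] {n : ℕ} (f : V [⋀^Fin n]→ₗ[A] M) :
    V [⋀^Fin n]→ₗ[k] M :=
  { f.toMultilinearMap.restrictScalars k with
    map_eq_zero_of_eq' := f.map_eq_zero_of_eq' }

/-! ### From the fundamental identity to the structure on differentials -/

namespace NambuPoisson

variable {k A : Type*} [Field k] [CommRing A] [Algebra k A] {p : ℕ} (P : NambuPoisson k A p)

theorem bracket_update_mul (v : Fin (p + 2) → A) (i : Fin (p + 2)) (b c : A) :
    P.bracket (Function.update v i (b * c)) =
      b • P.bracket (Function.update v i c) + c • P.bracket (Function.update v i b) := by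
  have h : ∀ x, P.bracket (Function.update v i x) = (-1 : ℤ) ^ (i : ℕ) • (-1 : ℤ) ^ (p + 1) •
      P.bracket (Fin.snoc (i.removeNth v) x) := fun x => by
    rw [← Fin.insertNth_removeNth, P.bracket.map_insertNth, P.bracket.map_snoc_eq_map_cons,
      smul_smul (_ ^ (p + 1)), ← pow_add, Even.neg_one_pow ⟨_, rfl⟩, one_smul]
    rfl
  simp only [h, P.leibniz, smul_add, smul_eq_mul, mul_smul_comm]

/-- The fundamental identity with all nested brackets moved to the front; as p + 1 is odd, both
sides acquire one minus sign. -/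
theorem bracket_cons_bracket (hp : Even p) (x : Fin (p + 2) → A) (y : Fin (p + 1) → A) :
    P.bracket (Fin.cons (P.bracket x) y) = ∑ l : Fin (p + 2), (-1 : ℤ) ^ (l : ℕ) •
      P.bracket (Fin.cons (P.bracket (Fin.cons (x l) y)) (l.removeNth x)) := by
  have h := P.fundamental y x
  simp only [P.bracket.map_snoc_eq_map_cons, hp.add_one.neg_one_pow, neg_smul, one_smul] at h
  rw [← neg_inj, h, ← Finset.sum_neg_distrib]
  refine Finset.sum_congr rfl fun l _ => ?_
  rw [P.bracket.map_update_neg, ← Fin.insertNth_removeNth, P.bracket.map_insertNth]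
  rfl

/-- The fundamental identity implies the Jacobi identity as a signed sum over permutations. -/
theorem jacobiator_eq_zero [CharZero k] (hp : Even p) (v : Fin (2 * p + 2 + 1) → A) :
    jacobiator P.bracket v = 0 := by
  -- The `l = 0` term of the fundamental identity; the other terms are obtained from it by a cycle
  -- of sign (-1)^l, so all p + 2 have the same signed sum.
  let H : (Fin (p + 2) → A) → (Fin (p + 1) → A) → A := fun x y =>
    P.bracket (Fin.cons (P.bracket (Fin.cons (x 0) y)) (Fin.tail x))
  have hH : jacobiator P.bracket v = (p + 2) •
      shuffleSum (q := p + 2) (r := p + 1) (by omega) H v := by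
    have e : ∀ x y, P.bracket (Fin.cons (P.bracket x) y) = ∑ l : Fin (p + 2),
        (-1 : ℤ) ^ (l : ℕ) • H (x ∘ l.cycleRange.symm) y := fun x y => by
      rw [P.bracket_cons_bracket hp]
      refine Finset.sum_congr rfl fun l _ => ?_
      rw [← Fin.cons_removeNth_eq_comp_cycleRange_symm]
      rfl
    have e' : jacobiator P.bracket v = ∑ l : Fin (p + 2), (-1 : ℤ) ^ (l : ℕ) •
        shuffleSum (q := p + 2) (r := p + 1) (by omega)
          (fun x y => H (x ∘ l.cycleRange.symm) y) v := by
      rw [jacobiator, shuffleSum_congr _ e]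
      simp only [shuffleSum, Finset.smul_sum]
      rw [Finset.sum_comm]
      exact Finset.sum_congr rfl fun _ _ => Finset.sum_congr rfl fun _ _ => smul_comm _ _ _
    rw [e', Finset.sum_congr rfl
      (g := fun _ => shuffleSum (q := p + 2) (r := p + 1) (by omega) H v)]
    · simp
    · intro l _
      rw [shuffleSum_comp_first, Equiv.Perm.sign_symm, Fin.sign_cycleRange, smul_smul]
      push_cast
      rw [← pow_add, Even.neg_one_pow ⟨_, rfl⟩, one_smul]
  have hrot : shuffleSum (q := p + 2) (r := p + 1) (by omega) H v = -jacobiator P.bracket v := by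
    -- `π` fixes the first letter and exchanges the two following blocks of size p + 1, taking {{x₀,
    -- y}, x₁, …} to the summand of the jacobiator.
    let π : Equiv.Perm (Fin (2 * p + 2 + 1)) :=
      Equiv.Perm.decomposeFin.symm (0, finRotate (2 * p + 1 + 1) ^ (p + 1))
    have hπ : ((Equiv.Perm.sign π : ℤˣ) : ℤ) = -1 := by
      have h1 : Odd ((2 * p + 1) * (p + 1)) := (odd_two_mul_add_one p).mul hp.add_one
      simp only [π, Equiv.Perm.decomposeFin.symm_sign, map_pow, sign_finRotate, ← pow_mul]
      simp [h1.neg_one_pow]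
    rw [← neg_one_smul ℤ, ← hπ, jacobiator, shuffleSum, shuffleSum,
      ← sum_sign_smul_comp_perm (fun x => P.bracket (Fin.cons (P.bracket (firstBlock _ x))
        (lastBlock _ x)))]
    have hval : ∀ (i : Fin (2 * p + 2)), (π i.succ : ℕ) = (i + (p + 1)) % (2 * p + 2) + 1 := by
      intro i
      simp only [π, Equiv.Perm.decomposeFin_symm_apply_succ, Equiv.swap_self, Equiv.refl_apply,
        Fin.val_succ]
      exact congrArg (· + 1) (finRotate_pow_val (p + 1) i)
    have hπ0 : π 0 = 0 := by simp [π]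
    refine Finset.sum_congr rfl fun σ _ => ?_
    congr 1
    simp only [H]
    congr 2
    · congr 2
      funext i
      refine Fin.cases ?_ (fun i => ?_) i
      · exact congrArg (fun t => v (σ t)) hπ0.symm
      · refine congrArg (fun t => v (σ t)) (Fin.ext ?_)
        have e : Fin.cast (by omega) (Fin.castAdd (p + 1) i.succ) =
          Fin.succ (⟨i, by omega⟩ : Fin (2 * p + 2)) := rfl
        have := i.isLt
        rw [e, hval, Nat.mod_eq_of_lt] <;> simp <;> omega
    · funext i
      refine congrArg (fun t => v (σ t)) (Fin.ext ?_)
      have e : Fin.cast (by omega) (Fin.natAdd (p + 1 + 1) i) =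
        Fin.succ (⟨p + 1 + i, by omega⟩ : Fin (2 * p + 2)) := Fin.ext (by simp; omega)
      have := i.isLt
      rw [e, hval]
      simp only [Fin.val_cast, Fin.val_castAdd, Fin.val_succ]
      rw [show p + 1 + (i : ℕ) + (p + 1) = i + (2 * p + 2) by omega, Nat.add_mod_right,
        Nat.mod_eq_of_lt] <;> omega
  -- Now J = -(p + 2) J, and p + 3 is invertible in `k`.
  rw [hrot, smul_neg, eq_neg_iff_add_eq_zero, ← succ_nsmul', ← Nat.cast_smul_eq_nsmul k] at hH
  exact (smul_eq_zero.mp hH).resolve_left (Nat.cast_ne_zero.mpr (Nat.succ_ne_zero _))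

variable [CharZero k]

theorem exists_poissonTensor : ∃ F : Ω[A⁄k] [⋀^Fin (p + 2)]→ₗ[A] A,
    ∀ a, F (fun i => KaehlerDifferential.D k A (a i)) = P.bracket a :=
  KaehlerDifferential.exists_alternatingMap_D P.bracket P.bracket_update_mul

/-- The `A`-multilinear form on differentials determined by the bracket. -/
noncomputable def poissonTensor : Ω[A⁄k] [⋀^Fin (p + 2)]→ₗ[A] A :=
  P.exists_poissonTensor.choose

theorem poissonTensor_D (a : Fin (p + 2) → A) :
    P.poissonTensor (fun i => KaehlerDifferential.D k A (a i)) = P.bracket a :=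
  P.exists_poissonTensor.choose_spec a

/-- Contraction of the Poisson tensor with `m - 1` differentials. -/
noncomputable def contraction (v : Fin (p + 1) → Ω[A⁄k]) : Ω[A⁄k] →ₗ[A] A where
  toFun w := P.poissonTensor (Fin.snoc v w)
  map_add' w w' := by
    simp only [AlternatingMap.map_snoc_eq_map_cons, AlternatingMap.map_cons_add, smul_add]
  map_smul' a w := by
    simp only [AlternatingMap.map_snoc_eq_map_cons, AlternatingMap.map_cons_smul, RingHom.id_apply,
      smul_comm a]

/-- The vector field of `m - 1` differentials. -/
noncomputable def vectorField : Ω[A⁄k] [⋀^Fin (p + 1)]→ₗ[A] Derivation k A A where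
  toFun v := (P.contraction v).compDer (KaehlerDifferential.D k A)
  map_update_add' := by
    intro inst v i x y
    obtain rfl : inst = instDecidableEqFin (p + 1) := Subsingleton.elim _ _
    ext b
    change P.poissonTensor (Fin.snoc _ _) = P.poissonTensor (Fin.snoc _ _) + P.poissonTensor (Fin.snoc _ _)
    rw [Fin.snoc_update, Fin.snoc_update, Fin.snoc_update, AlternatingMap.map_update_add]
  map_update_smul' := by
    intro inst v i t x
    obtain rfl : inst = instDecidableEqFin (p + 1) := Subsingleton.elim _ _
    ext b
    change P.poissonTensor (Fin.snoc _ _) = t • P.poissonTensor (Fin.snoc _ _)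
    rw [Fin.snoc_update, Fin.snoc_update, AlternatingMap.map_update_smul]
  map_eq_zero_of_eq' := by
    intro v i j hij hne
    ext b
    refine P.poissonTensor.map_eq_zero_of_eq _ (i := i.castSucc) (j := j.castSucc) ?_ ?_
    · simpa using hij
    · simpa using hne

theorem vectorField_apply (v : Fin (p + 1) → Ω[A⁄k]) (b : A) :
    P.vectorField v b = P.poissonTensor (Fin.snoc v (KaehlerDifferential.D k A b)) :=
  rfl

theorem liftKaehlerDifferential_vectorField (v : Fin (p + 1) → Ω[A⁄k]) (w : Ω[A⁄k]) :
    (P.vectorField v).liftKaehlerDifferential w = P.poissonTensor (Fin.snoc v w) := by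
  induction w using KaehlerDifferential.induction_smul_D with
  | hD b => exact Derivation.liftKaehlerDifferential_comp_D _ b
  | hadd ω η h₁ h₂ => rw [map_add, h₁, h₂]; exact ((P.contraction v).map_add ω η).symm
  | hsmul a ω h => rw [map_smul, h]; exact ((P.contraction v).map_smul a ω).symm

theorem vectorField_D (a : Fin (p + 1) → A) :
    P.vectorField (fun i => KaehlerDifferential.D k A (a i)) = P.hamiltonian a := by
  ext b
  rw [vectorField_apply]
  refine Eq.trans ?_ (P.poissonTensor_D (Fin.snoc a b))
  congr 1
  funext j
  refine Fin.lastCases ?_ (fun i => ?_) j <;> simp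

/-- The anchor on Kähler differentials. -/
noncomputable def anchor : Ω[A⁄k] [⋀^Fin (p + 1)]→ₗ[A] (A →ₗ[k] A) :=
  LinearMap.compAlternatingMap
    { toFun := fun X : Derivation k A A => (X : A →ₗ[k] A)
      map_add' := fun _ _ => rfl
      map_smul' := fun _ _ => rfl } P.vectorField

theorem anchor_apply (v : Fin (p + 1) → Ω[A⁄k]) (b : A) : P.anchor v b = P.vectorField v b :=
  rfl

theorem anchor_D (a : Fin (p + 1) → A) :
    P.anchor (fun i => KaehlerDifferential.D k A (a i)) = (P.hamiltonian a : A →ₗ[k] A) :=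
  congrArg (fun X : Derivation k A A => (X : A →ₗ[k] A)) (P.vectorField_D a)

theorem anchor_D_apply (a : Fin (p + 1) → A) (b : A) :
    P.anchor (fun i => KaehlerDifferential.D k A (a i)) b = P.bracket (Fin.snoc a b) := by
  rw [anchor_D]
  rfl

theorem anchor_mul (v : Fin (p + 1) → Ω[A⁄k]) (a b : A) :
    P.anchor v (a * b) = a * P.anchor v b + b * P.anchor v a :=
  (P.vectorField v).leibniz a b

/-- The Lie derivative of a differential along the vector field of `m - 1` differentials. -/
noncomputable def lieDerivativeMap : Ω[A⁄k] →ₗ[k] Ω[A⁄k] [⋀^Fin (p + 1)]→ₗ[k] Ω[A⁄k] where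
  toFun w := LinearMap.compAlternatingMap
    { toFun := fun X => KaehlerDifferential.lieDerivative X w
      map_add' := fun X Y => KaehlerDifferential.lieDerivative_add_left X Y w
      map_smul' := fun c X => KaehlerDifferential.lieDerivative_field_smul_left X c w }
    (P.vectorField.restrictBase k)
  map_add' w w' := by
    ext v
    exact map_add (KaehlerDifferential.lieDerivative (P.vectorField v)) w w'
  map_smul' c w := by
    ext v
    exact map_smul (KaehlerDifferential.lieDerivative (P.vectorField v)) c w

/-- The bracket of Kähler differentials. -/
noncomputable def differentialBracket : Ω[A⁄k] [⋀^Fin (p + 2)]→ₗ[k] Ω[A⁄k] :=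
  -- For p = 0 this is the Koszul bracket L_{X(v₀)} v₁ - L_{X(v₁)} v₀ - dπ(v₀, v₁). On exact
  -- differentials each of the p + 2 Lie terms contributes d{a}, so p + 1 copies are subtracted.
  -AlternatingMap.alternatizeUncurryFin P.lieDerivativeMap -
    (p + 1) • (KaehlerDifferential.D k A : A →ₗ[k] Ω[A⁄k]).compAlternatingMap
      (P.poissonTensor.restrictBase k)

theorem differentialBracket_apply (v : Fin (p + 2) → Ω[A⁄k]) :
    P.differentialBracket v =
      -∑ i : Fin (p + 2), (-1 : ℤ) ^ (i : ℕ) •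
        KaehlerDifferential.lieDerivative (P.vectorField (i.removeNth v)) (v i) -
      (p + 1) • KaehlerDifferential.D k A (P.poissonTensor v) := by
  rw [differentialBracket, AlternatingMap.sub_apply, AlternatingMap.neg_apply,
    AlternatingMap.alternatizeUncurryFin_apply]
  rfl

theorem poissonTensor_snoc_removeNth (hp : Even p) (i : Fin (p + 2)) (v : Fin (p + 2) → Ω[A⁄k]) :
    P.poissonTensor (Fin.snoc (i.removeNth v) (v i)) = -((-1 : ℤ) ^ (i : ℕ) • P.poissonTensor v) := by
  rw [AlternatingMap.map_snoc_removeNth, hp.add_one.neg_one_pow, neg_one_smul]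

theorem differentialBracket_D (hp : Even p) (a : Fin (p + 2) → A) :
    P.differentialBracket (fun i => KaehlerDifferential.D k A (a i)) =
      KaehlerDifferential.D k A (P.bracket a) := by
  have h : ∀ i : Fin (p + 2), (-1 : ℤ) ^ (i : ℕ) • KaehlerDifferential.lieDerivative
      (P.vectorField (i.removeNth fun i => KaehlerDifferential.D k A (a i)))
        (KaehlerDifferential.D k A (a i)) = -KaehlerDifferential.D k A (P.bracket a) := fun i => by
    rw [KaehlerDifferential.lieDerivative_D, vectorField_apply,
      P.poissonTensor_snoc_removeNth hp i (fun i => KaehlerDifferential.D k A (a i)),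
      poissonTensor_D, map_neg, map_zsmul, smul_neg, neg_one_pow_smul_self_smul]
  rw [differentialBracket_apply, poissonTensor_D]
  simp only [h, Finset.sum_neg_distrib, neg_neg, Finset.sum_const, Finset.card_univ,
    Fintype.card_fin]
  module

/-- In the p + 1 Lie terms where `w` enters the vector field, the corrections add up to (p + 1) π(v,
w) da, cancelled by the one from (p + 1) d(a π(v, w)). The Lie derivative of `a • w` itself leaves
the anchor term. -/
theorem differentialBracket_snoc_smul (hp : Even p) (v : Fin (p + 1) → Ω[A⁄k]) (a : A)
    (w : Ω[A⁄k]) :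
    P.differentialBracket (Fin.snoc v (a • w)) =
      a • P.differentialBracket (Fin.snoc v w) + P.anchor v a • w := by
  have hT : P.poissonTensor (Fin.snoc v (a • w)) = a • P.poissonTensor (Fin.snoc v w) :=
    (P.contraction v).map_smul a w
  have hr : ∀ (j : Fin (p + 1)) (z : Ω[A⁄k]), j.castSucc.removeNth (Fin.snoc v z : Fin (p + 2) → Ω[A⁄k])
      = (Fin.snoc (j.removeNth v) z : Fin (p + 1) → Ω[A⁄k]) := fun j z => by
    funext l
    refine Fin.lastCases ?_ (fun l => ?_) l
    · simp [Fin.removeNth]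
    · simp only [Fin.removeNth, Fin.snoc_castSucc, Fin.castSucc_succAbove_castSucc]
  have hX : ∀ (j : Fin (p + 1)), P.vectorField (Fin.snoc (j.removeNth v) (a • w)) =
      a • P.vectorField (Fin.snoc (j.removeNth v) w) := fun j => by
    rw [AlternatingMap.map_snoc_eq_map_cons, AlternatingMap.map_cons_smul, smul_comm,
      ← AlternatingMap.map_snoc_eq_map_cons]
  have hj : ∀ j : Fin (p + 1), (-1 : ℤ) ^ (j : ℕ) • KaehlerDifferential.lieDerivative
      (P.vectorField (Fin.snoc (j.removeNth v) (a • w))) (v j) =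
      a • (-1 : ℤ) ^ (j : ℕ) • KaehlerDifferential.lieDerivative
        (P.vectorField (Fin.snoc (j.removeNth v) w)) (v j) -
      P.poissonTensor (Fin.snoc v w) • KaehlerDifferential.D k A a := fun j => by
    have h := P.poissonTensor_snoc_removeNth hp j.castSucc (Fin.snoc v w)
    rw [hr, Fin.snoc_castSucc] at h
    rw [hX, KaehlerDifferential.lieDerivative_smul_left, liftKaehlerDifferential_vectorField, h,
      smul_add, neg_smul, smul_neg, smul_assoc, Fin.val_castSucc, neg_one_pow_smul_self_smul,
      smul_comm a, sub_eq_add_neg]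
  simp only [differentialBracket_apply, Fin.sum_univ_castSucc, Fin.snoc_castSucc, Fin.snoc_last,
    hr, Fin.val_castSucc, Fin.val_last, hp.add_one.neg_one_pow, hT, hj, Finset.sum_sub_distrib,
    ← Finset.smul_sum, Finset.sum_const, Finset.card_univ, Fintype.card_fin,
    KaehlerDifferential.lieDerivative_smul, anchor_apply, Derivation.leibniz, smul_eq_mul]
  have hl : ∀ z, (Fin.last (p + 1)).removeNth (Fin.snoc v z : Fin (p + 2) → Ω[A⁄k]) = v :=
    fun z => by rw [Fin.removeNth_last, Fin.init_snoc]
  simp only [hl]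
  module

/-- This defect is the jacobiator of the Nambu bracket at (f, a), split according to whether `f`
lies in the inner or the outer bracket. -/
theorem anchorDefect_D (hp : Even p) (f : A) (a : Fin (2 * p + 1 + 1) → A) :
    anchorDefect P.differentialBracket P.anchor f (fun i => KaehlerDifferential.D k A (a i)) = 0 := by
  refine Eq.trans ?_ (P.jacobiator_eq_zero hp (Fin.cons f a))
  have hs := hp.add_one.neg_one_pow (α := ℤ)
  have hD : ∀ {n : ℕ} (x : A) (y : Fin n → A),
      (Fin.cons (KaehlerDifferential.D k A x) (KaehlerDifferential.D k A ∘ y) :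
        Fin (n + 1) → Ω[A⁄k]) = fun i => KaehlerDifferential.D k A
          ((Fin.cons x y : Fin (n + 1) → A) i) := by
    intro n x y
    funext i
    refine Fin.cases rfl (fun _ => rfl) i
  rw [jacobiator_cons hp, anchorDefect]
  refine (add_comm _ _).trans ?_
  congr 2
  · rw [anchorAnchorSum]
    refine (shuffleSum_comp_map _ (KaehlerDifferential.D k A) _ a).trans
      (shuffleSum_congr _ (fun x y => ?_) a)
    have h := P.anchor_D_apply x f
    have h' := P.anchor_D_apply y (P.bracket (Fin.snoc x f))
    rw [← h] at h'
    refine h'.trans ?_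
    rw [h, AlternatingMap.map_snoc_eq_map_cons, AlternatingMap.map_snoc_eq_map_cons, hs,
      neg_one_smul, neg_one_smul, AlternatingMap.map_cons_neg, neg_neg]
  · rw [anchorBracketSum]
    refine (shuffleSum_comp_map _ (KaehlerDifferential.D k A) _ a).trans
      (shuffleSum_congr _ (fun x y => ?_) a)
    change P.anchor (Fin.cons (P.differentialBracket fun i => KaehlerDifferential.D k A (x i))
      (KaehlerDifferential.D k A ∘ y)) f = _
    rw [P.differentialBracket_D hp, hD, anchor_D_apply, AlternatingMap.map_snoc_eq_map_cons, hs,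
      neg_one_smul, P.bracket.map_cons_cons, neg_neg]

/-- Since `d` intertwines the brackets, this is `d` applied to the jacobiator on functions. -/
theorem jacobiator_D (hp : Even p) (a : Fin (2 * p + 2 + 1) → A) :
    jacobiator P.differentialBracket (fun i => KaehlerDifferential.D k A (a i)) = 0 := by
  have h := congrArg (KaehlerDifferential.D k A) (P.jacobiator_eq_zero hp a)
  rw [map_zero] at h
  refine Eq.trans ?_ h
  rw [jacobiator, jacobiator]
  refine ((shuffleSum_comp_map _ (KaehlerDifferential.D k A) _ a).trans
      (shuffleSum_congr _ (fun x y => ?_) a)).trans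
    (shuffleSum_map ((KaehlerDifferential.D k A : A →ₗ[k] Ω[A⁄k]) : A →+ Ω[A⁄k]) _ _ a)
  change P.differentialBracket (Fin.cons (P.differentialBracket fun i =>
    KaehlerDifferential.D k A (x i)) (KaehlerDifferential.D k A ∘ y)) =
      KaehlerDifferential.D k A (P.bracket (Fin.cons (P.bracket x) y))
  rw [P.differentialBracket_D hp]
  refine Eq.trans ?_ (P.differentialBracket_D hp _)
  congr 1
  funext i
  refine Fin.cases rfl (fun _ => rfl) i

theorem anchorDefect_eq_zero (hp : Even p) (f : A) (v : Fin (2 * p + 1 + 1) → Ω[A⁄k]) :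
    anchorDefect P.differentialBracket P.anchor f v = 0 :=
  anchorDefect_eq_zero_of_span (KaehlerDifferential.span_range_derivation k A) hp
    (P.differentialBracket_snoc_smul hp) P.anchor_mul f
    (KaehlerDifferential.forall_of_mem_range_D (P.anchorDefect_D hp f)) v

/-- The Lie-Rinehart `m`-algebra of Kähler differentials of a Nambu-Poisson algebra. -/
noncomputable def lieRinehart (hp : Even p) : LieRinehartMAlgebra k A Ω[A⁄k] p where
  bracket := P.differentialBracket
  anchor := P.anchor
  jacobi := sum_unshuffles_bracket_bracket
    (jacobiator_eq_zero_of_span (KaehlerDifferential.span_range_derivation k A) hp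
      (P.differentialBracket_snoc_smul hp) (P.anchorDefect_eq_zero hp)
      (KaehlerDifferential.forall_of_mem_range_D (P.jacobiator_D hp)))
  bracket_leibniz := P.differentialBracket_snoc_smul hp
  anchor_bracket := sum_unshuffles_anchor (P.anchorDefect_eq_zero hp)
  anchor_leibniz := P.anchor_mul

end NambuPoisson

/-! ### Uniqueness and the theorem -/

/-- A Lie-Rinehart `m`-algebra structure on Kähler differentials is determined by its values on
exact differentials. -/
theorem LieRinehartMAlgebra.ext_of_D {k A : Type*} [Field k] [CommRing A] [Algebra k A] {p : ℕ}
    {L L' : LieRinehartMAlgebra k A Ω[A⁄k] p}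
    (hb : ∀ a : Fin (p + 2) → A, L.bracket (fun i => KaehlerDifferential.D k A (a i)) =
      L'.bracket (fun i => KaehlerDifferential.D k A (a i)))
    (ha : ∀ a : Fin (p + 1) → A, L.anchor (fun i => KaehlerDifferential.D k A (a i)) =
      L'.anchor (fun i => KaehlerDifferential.D k A (a i))) : L = L' := by
  have hanchor : L.anchor = L'.anchor := by
    have := KaehlerDifferential.eq_of_forall_D (k := k)
      (F := L.anchor.toMultilinearMap) (G := L'.anchor.toMultilinearMap) ha
    ext1 v
    exact congrArg (fun F => F v) this
  refine LieRinehartMAlgebra.ext ?_ hanchor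
  ext1 v
  rw [← sub_eq_zero, ← AlternatingMap.sub_apply]
  refine eq_zero_of_span_eq_top_of_skew (KaehlerDifferential.span_range_derivation k A)
    (fun v => (L.bracket - L'.bracket) v) ((L.bracket - L'.bracket).map_comp_perm)
    ((L.bracket - L'.bracket).map_cons_add) (fun a x u => ?_)
    (KaehlerDifferential.forall_of_mem_range_D fun a => ?_) v
  -- Once the anchors agree, their terms cancel in the difference of the two Leibniz rules, so the
  -- difference of brackets is `A`-linear.
  · have h : ∀ w, (L.bracket - L'.bracket) (Fin.cons w u) = (-1 : ℤ) ^ (p + 1) •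
        (L.bracket - L'.bracket) (Fin.snoc u w) := fun w => by
      rw [AlternatingMap.map_snoc_eq_map_cons, neg_one_pow_smul_self_smul]
    rw [h, h, smul_comm a, AlternatingMap.sub_apply, AlternatingMap.sub_apply, L.bracket_leibniz,
      L'.bracket_leibniz, hanchor, add_sub_add_right_eq_sub, ← smul_sub]
  · exact sub_eq_zero.mpr (hb a)

theorem corollary1p3 {k S : Type*} [Field k] [CharZero k] [CommRing S] [Algebra k S]
    (p : ℕ) (hm : Even (p + 2)) (P : NambuPoisson k S p) (I : Ideal S) (hI : P.IsNambuIdeal I) :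
    ∃! L : LieRinehartMAlgebra k (S ⧸ I) (Ω[(S ⧸ I)⁄k]) p,
      (∀ a : Fin (p + 2) → S ⧸ I,
        L.bracket (fun i => KaehlerDifferential.D k (S ⧸ I) (a i)) =
          KaehlerDifferential.D k (S ⧸ I) ((P.quotient I hI).bracket a)) ∧
      ∀ a : Fin (p + 1) → S ⧸ I,
        L.anchor (fun i => KaehlerDifferential.D k (S ⧸ I) (a i)) =
          ((P.quotient I hI).hamiltonian a : (S ⧸ I) →ₗ[k] (S ⧸ I)) := by
  have hp : Even p := by simpa [Nat.even_add] using hm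
  refine ⟨(P.quotient I hI).lieRinehart hp,
    ⟨(P.quotient I hI).differentialBracket_D hp, (P.quotient I hI).anchor_D⟩, ?_⟩
  rintro L ⟨hb, ha⟩
  refine LieRinehartMAlgebra.ext_of_D (fun a => ?_) (fun a => ?_)
  · exact (hb a).trans ((P.quotient I hI).differentialBracket_D hp a).symm
  · exact (ha a).trans ((P.quotient I hI).anchor_D a).symm
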